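/- Let $d\in\mathbb N$, $\ell\ge 0$, and let $\mathcal P_\ell(\mathbb R^d)$ be the set of probability measures $m$ on $\mathbb R^d$ with $\int|x|^\ell\,m(dx)<\infty$. A function $U:\mathcal P_\ell(\mathbb R^d)\to\mathbb R$ admits a linear functional derivative at $\mu$ if there is a measurable function $y\mapsto\frac{\delta U}{\delta m}(\mu,y)$ with $\sup_y|\frac{\delta U}{\delta m}(\mu,y)|/(1+|y|^\ell)<\infty$ and $$\frac{d}{d\varepsilon}\Big|_{\varepsilon=0^+}U(\mu+\varepsilon(\nu-\mu))=\int_{\mathbb R^d}\frac{\delta U}{\delta m}(\mu,y)\,(\nu-\mu)(dy)\qquad\text{for all }\nu\in\mathcal P_\ell(\mathbb R^d);$$ it is unique once normalised by $\frac{\delta U}{\delta m}(\mu,0)=0$. Inductively, $\frac{\delta^{j}U}{\delta m^{j}}(\mu,y_1,\dots,y_j)$ is the normalised linear functional derivative, at $\mu$ and in the new variable $y_j$, of $m\mapsto\frac{\delta^{j-1}U}{\delta m^{j-1}}(m,y_1,\dots,y_{j-1})$. For $k\ge0$, $U$ belongs to $\mathcal S_{j,k}(\mathcal P_\ell(\mathbb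 R^d))$ if for each $1\le i\le j$ the derivative $\frac{\delta^iU}{\delta m^i}$ exists on $\mathcal P_\ell(\mathbb R^d)\times(\mathbb R^d)^i$, is measurable in $(x_1,\dots,x_i)$ for each $\mu$, and, for some $C<\infty$ and all $\mu,x_1,\dots,x_i$, $$\Big|\frac{\delta^iU}{\delta m^i}(\mu,x_1,\dots,x_i)\Big|\le C\Big(1+|x_1|^k+\dots+|x_i|^k+1_{\{\ell>0\}}\Big(\int|x|^\ell\mu(dx)\Big)^{k/\ell}\Big).$$ Let $m_0\in\mathcal P_\ell(\mathbb R^d)$ be discrete (carried by a countable set), let $\zeta_1,\zeta_2,\dots$ be i.i.d. random variables with law $m_0$, and let $m^N=\frac1N\sum_{i=1}^N\delta_{\zeta_i}$. Suppose that $U\in\mathcal S_{1,\ell/2}(\mathcal P_\ell(\mathbb R^d))\cap\mathcal S_{2,\ell}(\mathcal P_\ell(\mathbb R^d))$ and that there is $C<\infty$ such that for all $(\mu,x,y)\in\mathcal P_\ell(\mathbb R^d)\times\mathbb R^d\times\mathbb R^d$ $$\Big|\frac{\delta^2U}{\delta m^2}(\mu,x,y)\Big|\le C\Big(1+|x|^{\ell/2}+|y|^\ell+\int_{\mathbb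 R^d}|z|^\ell\mu(dz)\Big).$$ Then, as $N\to\infty$, $$\sqrt N\,\big(U(m^N)-U(m_0)\big)\ \longrightarrow\ \mathcal N\Big(0,\ \mathrm{Var}\Big(\frac{\delta U}{\delta m}(m_0,\zeta_1)\Big)\Big)\quad\text{in distribution},$$ and furthermore $$\sup_{N\ge1}\sqrt N\;\mathbb E\big|U(m^N)-U(m_0)\big|<\infty .$$ -/

import Mathlib

open MeasureTheory ProbabilityTheory Filter Topology Set
open scoped ENNReal NNReal

namespace EmpiricalCLT

/-- The Euclidean space `ℝ^d`. -/
abbrev E (d : ℕ) : Type := EuclideanSpace ℝ (Fin d)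

/-- `𝒫_ℓ(ℝ^d)`: the probability measures `m` on `ℝ^d` with `∫ |x|^ℓ m(dx) < ∞`.
For `ℓ = 0` the moment condition is void, as `r ^ (0 : ℝ) = 1` for every real `r`. -/
structure PSpace (d : ℕ) (ℓ : ℝ) where
  /-- the underlying measure -/
  meas : Measure (E d)
  isProb : IsProbabilityMeasure meas
  integrable_moment : Integrable (fun x : E d => ‖x‖ ^ ℓ) meas

attribute [instance] PSpace.isProb

variable {d : ℕ} {ℓ : ℝ}

/-- The moment `∫ |x|^ℓ μ(dx)`. -/
noncomputable def PSpace.moment (μ : PSpace d ℓ) : ℝ := ∫ x, ‖x‖ ^ ℓ ∂μ.meas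

/-- The Dirac mass at `x`. -/
noncomputable def diracP (d : ℕ) (ℓ : ℝ) (x : E d) : PSpace d ℓ where
  meas := Measure.dirac x
  isProb := inferInstance
  integrable_moment := integrable_dirac (by simp)

/-- The measure `μ + t (ν - μ) = (1 - t) μ + t ν` for `t ∈ [0,1]`. -/
noncomputable def mix (μ ν : PSpace d ℓ) (t : unitInterval) : PSpace d ℓ where
  meas := ENNReal.ofReal (1 - t) • μ.meas + ENNReal.ofReal t • ν.meas
  isProb := ⟨by
    have h1 : (0 : ℝ) ≤ 1 - t := sub_nonneg.2 t.2.2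
    simp [← ENNReal.ofReal_add h1 t.2.1]⟩
  integrable_moment :=
    (μ.integrable_moment.smul_measure ENNReal.ofReal_ne_top).add_measure
      (ν.integrable_moment.smul_measure ENNReal.ofReal_ne_top)

/-- `g` is a (not yet normalised) linear functional derivative of `U : 𝒫_ℓ(ℝ^d) → ℝ` at `μ`:
it is measurable, it has growth of order `ℓ`, and for every `ν ∈ 𝒫_ℓ(ℝ^d)` the right-hand
derivative of `ε ↦ U (μ + ε (ν - μ))` at `ε = 0` equals `∫ g d(ν - μ)`.
Here `projIcc` is the identity on `[0,1]`, so only `ε ∈ [0,1]` matters. -/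
def IsLinDeriv (U : PSpace d ℓ → ℝ) (μ : PSpace d ℓ) (g : E d → ℝ) : Prop :=
  Measurable g ∧ (∃ C : ℝ, ∀ y, |g y| ≤ C * (1 + ‖y‖ ^ ℓ)) ∧
    ∀ ν : PSpace d ℓ,
      HasDerivWithinAt (fun ε : ℝ => U (mix μ ν (projIcc 0 1 zero_le_one ε)))
        (∫ y, g y ∂ν.meas - ∫ y, g y ∂μ.meas) (Ici 0) 0

/-- `U` admits a linear functional derivative at `μ`. -/
def AdmitsLinDeriv (U : PSpace d ℓ → ℝ) (μ : PSpace d ℓ) : Prop :=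
  ∃ g, IsLinDeriv U μ g

open Classical in
/-- The linear functional derivative `δU/δm (μ, ·)`, normalised to vanish at `y = 0`
(and `0` if `U` admits no linear functional derivative at `μ`).
It does not depend on the choice made here, see `IsLinDeriv.linDeriv_eq`. -/
noncomputable def linDeriv (U : PSpace d ℓ → ℝ) (μ : PSpace d ℓ) (y : E d) : ℝ :=
  if h : AdmitsLinDeriv U μ then h.choose y - h.choose 0 else 0

/-- Linear functional derivatives are unique up to an additive constant, so that the normalised
one is well defined. -/
theorem IsLinDeriv.linDeriv_eq {U : PSpace d ℓ → ℝ} {μ : PSpace d ℓ} {g : E d → ℝ}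
    (hg : IsLinDeriv U μ g) (y : E d) : linDeriv U μ y = g y - g 0 := by
  have h : AdmitsLinDeriv U μ := ⟨g, hg⟩
  have key : ∀ z, h.choose z - ∫ x, h.choose x ∂μ.meas = g z - ∫ x, g x ∂μ.meas := by
    intro z
    have h1 := h.choose_spec.2.2 (diracP d ℓ z)
    have h2 := hg.2.2 (diracP d ℓ z)
    have h3 := (uniqueDiffOn_Ici (0 : ℝ) 0 self_mem_Ici).eq_deriv _ h1 h2
    simpa [diracP, integral_dirac] using h3
  rw [linDeriv, dif_pos h]
  linarith [key y, key 0]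

/-- The iterated linear functional derivative `δ^i U/δm^i (m, y_1, …, y_i)`: for fixed
`y_1, …, y_i`, the function `m ↦ δ^i U/δm^i (m, y_1, …, y_i)` is differentiated once more, and the
new variable is put last. -/
noncomputable def iterLinDeriv (U : PSpace d ℓ → ℝ) :
    (i : ℕ) → PSpace d ℓ → (Fin i → E d) → ℝ
  | 0, m, _ => U m
  | i + 1, m, y =>
      linDeriv (fun m' => iterLinDeriv U i m' (fun k => y k.castSucc)) m (y (Fin.last i))

/-- The linear functional derivatives of `U` of orders `1, …, j` exist on all of `𝒫_ℓ(ℝ^d)`. -/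
def HasIterLinDeriv (U : PSpace d ℓ → ℝ) (j : ℕ) : Prop :=
  ∀ i < j, ∀ (y : Fin i → E d) (m : PSpace d ℓ),
    AdmitsLinDeriv (fun m' => iterLinDeriv U i m' y) m

open Classical in
/-- The class `𝒮_{j,k}(𝒫_ℓ(ℝ^d))`. -/
def ClassS (j : ℕ) (k : ℝ) (U : PSpace d ℓ → ℝ) : Prop :=
  HasIterLinDeriv U j ∧
    (∀ i, 1 ≤ i → i ≤ j → ∀ μ : PSpace d ℓ, Measurable (iterLinDeriv U i μ)) ∧
    ∃ C : ℝ, ∀ i, 1 ≤ i → i ≤ j → ∀ (μ : PSpace d ℓ) (x : Fin i → E d),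
      |iterLinDeriv U i μ x| ≤
        C * (1 + (∑ n, ‖x n‖ ^ k) + if 0 < ℓ then μ.moment ^ (k / ℓ) else 0)

/-- A probability measure is discrete if it is carried by a countable set. -/
def PSpace.IsDiscrete (μ : PSpace d ℓ) : Prop :=
  ∃ S : Set (E d), S.Countable ∧ μ.meas S = 1

/-- The empirical measure `(1/N) ∑_{i=1}^N δ_{x_i}` of the first `N` terms of a sequence, whose
terms are indexed from `0`. The value `δ_0` for `N = 0` is a convention without significance. -/
noncomputable def empirical (ℓ : ℝ) (x : ℕ → E d) (N : ℕ) : PSpace d ℓ :=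
  if hN : N = 0 then diracP d ℓ 0 else
    { meas := (N : ℝ≥0∞)⁻¹ • ∑ i ∈ Finset.range N, Measure.dirac (x i)
      isProb := ⟨by
        simp [ENNReal.inv_mul_cancel (Nat.cast_ne_zero.2 hN) (ENNReal.natCast_ne_top N)]⟩
      integrable_moment :=
        (integrable_finsetSum_measure.2 fun _ _ => integrable_dirac (by simp)).smul_measure
          (ENNReal.inv_ne_top.2 (Nat.cast_ne_zero.2 hN)) }

end EmpiricalCLT

/-! Write `m_n = (1/N) ∑_{i<n} δ_{ζ_i} + (1 - n/N) m₀`, which joins `m₀` (`n = 0`) to the empirical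
measure (`n = N`). Adding one sample changes it by `N⁻¹ (δ_{ζ_n} - m₀)`, so the telescoping sum of
`U(m_{n+1}) - U(m_n)`, expanded to first order at `m_n`, has centred leading terms (`sub_eq_sum`).
Replacing `δU/δm(m_n, ·)` by `δU/δm(m₀, ·)` splits the rescaled error into three sums: the
normalised i.i.d. sum of `δU/δm(m₀, ζ_n)`, governed by the classical central limit theorem; the sum
of `fluct`, a martingale transform. Its terms are orthogonal (`integral_sq_sum_eq`), so its second
moment is bounded by a Cesàro mean of the expected squared oscillation of `δU/δm` between `m₀` and
the empirical measure; the sum of `rem`, whose terms are `O(N⁻²)` in `L¹` by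
`Regular.abs_sub_sub_le`, so that `N` of them times `√N` vanish.

Discreteness enters twice. It makes empirical measures converge to `m₀` almost surely in weighted
total variation (`ae_tendsto_disc`), and the bound on `δ²U/δm²` turns this into vanishing
oscillation (`tendsto_integral_oscSq`). It also makes every functional of a finite sample a.e.
measurable, although no regularity of `U` in the measure argument is assumed. The last two sums thus
tend to `0` in `L¹`. Slutsky's theorem gives the limit law, and the `L²` bound on the linear part
gives the moment bound. -/

namespace EmpiricalCLT

variable {d : ℕ} {ℓ : ℝ}

/-! ### Differentiation along segments of measures -/

theorem PSpace.ext_meas {μ ν : PSpace d ℓ} (h : μ.meas = ν.meas) : μ = ν := by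
  cases μ; cases ν; cases h; rfl

theorem PSpace.integrable_of_growth (μ : PSpace d ℓ) {g : E d → ℝ} (hg : Measurable g) {C : ℝ}
    (hC : ∀ y, |g y| ≤ C * (1 + ‖y‖ ^ ℓ)) : Integrable g μ.meas :=
  (((integrable_const 1).add μ.integrable_moment).const_mul C).mono' hg.aestronglyMeasurable
    (ae_of_all _ fun y => by simpa using hC y)

theorem PSpace.moment_nonneg (μ : PSpace d ℓ) : 0 ≤ μ.moment :=
  integral_nonneg fun _ => by positivity

/-- The point `μ + t (ν - μ)` of the segment from `μ` to `ν`, for real `t` clamped to `[0,1]`. -/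
noncomputable def segm (μ ν : PSpace d ℓ) (t : ℝ) : PSpace d ℓ :=
  mix μ ν (projIcc 0 1 zero_le_one t)

theorem segm_meas (μ ν : PSpace d ℓ) {t : ℝ} (ht : t ∈ Icc (0 : ℝ) 1) :
    (segm μ ν t).meas = ENNReal.ofReal (1 - t) • μ.meas + ENNReal.ofReal t • ν.meas := by
  rw [segm, projIcc_of_mem _ ht]
  rfl

theorem integral_segm (μ ν : PSpace d ℓ) {t : ℝ} (ht : t ∈ Icc (0 : ℝ) 1) {g : E d → ℝ}
    (hμ : Integrable g μ.meas) (hν : Integrable g ν.meas) :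
    ∫ x, g x ∂(segm μ ν t).meas = (1 - t) * ∫ x, g x ∂μ.meas + t * ∫ x, g x ∂ν.meas := by
  rw [segm_meas μ ν ht, integral_add_measure (hμ.smul_measure ENNReal.ofReal_ne_top)
    (hν.smul_measure ENNReal.ofReal_ne_top), integral_smul_measure, integral_smul_measure,
    ENNReal.toReal_ofReal (sub_nonneg.2 ht.2), ENNReal.toReal_ofReal ht.1, smul_eq_mul, smul_eq_mul]

theorem moment_segm (μ ν : PSpace d ℓ) {t : ℝ} (ht : t ∈ Icc (0 : ℝ) 1) :
    (segm μ ν t).moment = (1 - t) * μ.moment + t * ν.moment :=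
  integral_segm μ ν ht μ.integrable_moment ν.integrable_moment

theorem moment_segm_le (μ ν : PSpace d ℓ) {t : ℝ} (ht : t ∈ Icc (0 : ℝ) 1) :
    (segm μ ν t).moment ≤ μ.moment + ν.moment := by
  rw [moment_segm μ ν ht]
  nlinarith [mul_nonneg ht.1 μ.moment_nonneg, mul_nonneg (sub_nonneg.2 ht.2) ν.moment_nonneg]

theorem segm_zero (μ ν : PSpace d ℓ) : segm μ ν 0 = μ :=
  PSpace.ext_meas (by simp [segm_meas])

theorem segm_one (μ ν : PSpace d ℓ) : segm μ ν 1 = ν :=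
  PSpace.ext_meas (by simp [segm_meas])

theorem segm_symm (μ ν : PSpace d ℓ) {t : ℝ} (ht : t ∈ Icc (0 : ℝ) 1) :
    segm ν μ (1 - t) = segm μ ν t :=
  PSpace.ext_meas (by
    rw [segm_meas _ _ ht, segm_meas _ _ ⟨sub_nonneg.2 ht.2, by linarith [ht.1]⟩, sub_sub_cancel,
      add_comm])

theorem segm_segm (μ ν : PSpace d ℓ) {s t : ℝ} (hs : s ∈ Icc (0 : ℝ) 1) (ht : t ∈ Icc (0 : ℝ) 1) :
    segm (segm μ ν s) ν t = segm μ ν (s + t * (1 - s)) := by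
  have h1 : 0 ≤ 1 - s := sub_nonneg.2 hs.2
  have h2 : 0 ≤ 1 - t := sub_nonneg.2 ht.2
  have h3 : 0 ≤ t * (1 - s) := mul_nonneg ht.1 h1
  refine PSpace.ext_meas ?_
  rw [segm_meas _ _ ht, segm_meas _ _ hs, segm_meas _ _ ⟨add_nonneg hs.1 h3, by nlinarith⟩,
    smul_add, smul_smul, smul_smul, add_assoc, ← add_smul, ← ENNReal.ofReal_mul h2,
    ← ENNReal.ofReal_mul h2, ← ENNReal.ofReal_add (mul_nonneg h2 hs.1) ht.1]
  congr 3 <;> ring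

theorem AdmitsLinDeriv.measurable_linDeriv {V : PSpace d ℓ → ℝ} {μ : PSpace d ℓ}
    (h : AdmitsLinDeriv V μ) : Measurable (linDeriv V μ) := by
  obtain ⟨g, hg⟩ := h
  rw [funext fun y => hg.linDeriv_eq y]
  exact hg.1.sub_const _

theorem AdmitsLinDeriv.integrable_linDeriv {V : PSpace d ℓ → ℝ} {μ : PSpace d ℓ}
    (h : AdmitsLinDeriv V μ) (ν : PSpace d ℓ) : Integrable (linDeriv V μ) ν.meas := by
  obtain ⟨g, hg⟩ := h
  rw [funext fun y => hg.linDeriv_eq y]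
  obtain ⟨C, hC⟩ := hg.2.1
  exact (ν.integrable_of_growth hg.1 hC).sub (integrable_const _)

theorem AdmitsLinDeriv.hasDerivWithinAt_segm {V : PSpace d ℓ → ℝ} {μ : PSpace d ℓ}
    (h : AdmitsLinDeriv V μ) (ν : PSpace d ℓ) :
    HasDerivWithinAt (fun t => V (segm μ ν t))
      (∫ y, linDeriv V μ y ∂ν.meas - ∫ y, linDeriv V μ y ∂μ.meas) (Ici 0) 0 := by
  obtain ⟨g, hg⟩ := h
  obtain ⟨C, hC⟩ := hg.2.1
  have h1 := hg.2.2 ν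
  rw [funext fun y => hg.linDeriv_eq y]
  rw [integral_sub (ν.integrable_of_growth hg.1 hC) (integrable_const _),
    integral_sub (μ.integrable_of_growth hg.1 hC) (integrable_const _)]
  simpa [segm] using h1

/-- The derivative of `t ↦ V (μ + t (ν - μ))`. -/
noncomputable def segmSlope (V : PSpace d ℓ → ℝ) (μ ν : PSpace d ℓ) (s : ℝ) : ℝ :=
  ∫ y, linDeriv V (segm μ ν s) y ∂ν.meas - ∫ y, linDeriv V (segm μ ν s) y ∂μ.meas

/-- The definition differentiates only at the start of a segment, so the segment is restarted at its
point `m_s`. As `ν - m_s = (1 - s)(ν - μ)`, the factor `1 - s` cancels the speed `1 / (1 - s)` of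
the reparametrisation `t ↦ (t - s) / (1 - s)`. -/
theorem hasDerivWithinAt_segm_right {V : PSpace d ℓ → ℝ} (hV : ∀ m, AdmitsLinDeriv V m)
    (μ ν : PSpace d ℓ) {s : ℝ} (hs : s ∈ Icc (0 : ℝ) 1) (hs1 : s < 1) :
    HasDerivWithinAt (fun t => V (segm μ ν t)) (segmSlope V μ ν s) (Icc s 1) s := by
  have h1 : 0 < 1 - s := sub_pos.2 hs1
  have key := (hV (segm μ ν s)).hasDerivWithinAt_segm ν
  have hlin : HasDerivWithinAt (fun t : ℝ => (t - s) / (1 - s)) (1 / (1 - s)) (Icc s 1) s :=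
    (((hasDerivAt_id s).sub_const s).div_const (1 - s)).hasDerivWithinAt
  have hmaps : MapsTo (fun t : ℝ => (t - s) / (1 - s)) (Icc s 1) (Ici 0) := fun t ht =>
    div_nonneg (sub_nonneg.2 ht.1) h1.le
  have hz : (s - s) / (1 - s) = 0 := by simp
  have h2 := HasDerivWithinAt.comp s (h₂ := fun t => V (segm (segm μ ν s) ν t))
    (by rw [hz]; exact key) hlin hmaps
  have hval : (∫ y, linDeriv V (segm μ ν s) y ∂ν.meas -
      ∫ y, linDeriv V (segm μ ν s) y ∂(segm μ ν s).meas) * (1 / (1 - s)) = segmSlope V μ ν s := by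
    rw [segmSlope, integral_segm μ ν hs ((hV _).integrable_linDeriv _) ((hV _).integrable_linDeriv _)]
    field_simp
    ring
  rw [hval] at h2
  refine h2.congr_of_mem (fun t ht => ?_) ⟨le_rfl, hs.2⟩
  have hmem : (t - s) / (1 - s) ∈ Icc (0 : ℝ) 1 :=
    ⟨hmaps ht, (div_le_one h1).2 (by linarith [ht.2])⟩
  simp only [Function.comp]
  rw [segm_segm μ ν hs hmem]
  congr 2
  field_simp
  ring

/-- The left derivative is the right derivative along the reversed segment, up to sign. -/
theorem hasDerivWithinAt_segm {V : PSpace d ℓ → ℝ} (hV : ∀ m, AdmitsLinDeriv V m)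
    (μ ν : PSpace d ℓ) {s : ℝ} (hs : s ∈ Icc (0 : ℝ) 1) :
    HasDerivWithinAt (fun t => V (segm μ ν t)) (segmSlope V μ ν s) (Icc 0 1) s := by
  have hr : HasDerivWithinAt (fun t => V (segm μ ν t)) (segmSlope V μ ν s) (Icc s 1) s := by
    rcases hs.2.lt_or_eq with h | h
    · exact hasDerivWithinAt_segm_right hV μ ν hs h
    -- At an endpoint the one-sided interval is a singleton, within which every number is a
    -- derivative.
    · rw [h, Icc_self]; simp [hasDerivWithinAt_iff_tendsto_slope]
  have hl : HasDerivWithinAt (fun t => V (segm μ ν t)) (segmSlope V μ ν s) (Icc 0 s) s := by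
    rcases hs.1.lt_or_eq with h | h
    · have hs' : 1 - s ∈ Icc (0 : ℝ) 1 := ⟨sub_nonneg.2 hs.2, by linarith⟩
      have h1 := hasDerivWithinAt_segm_right hV ν μ hs' (by linarith)
      have hlin : HasDerivWithinAt (fun t : ℝ => 1 - t) (-1) (Icc 0 s) s :=
        ((hasDerivAt_id s).const_sub 1).hasDerivWithinAt
      have h2 := HasDerivWithinAt.comp s (h₂ := fun t => V (segm ν μ t)) h1 hlin
        (fun t ht => ⟨by linarith [ht.2], by linarith [ht.1]⟩)
      have hval : segmSlope V ν μ (1 - s) * -1 = segmSlope V μ ν s := by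
        rw [segmSlope, segm_symm μ ν hs, segmSlope]; ring
      rw [hval] at h2
      refine h2.congr_of_mem (fun t ht => ?_) ⟨hs.1, le_rfl⟩
      simp only [Function.comp]
      rw [segm_symm μ ν ⟨ht.1, ht.2.trans hs.2⟩]
    · rw [← h, Icc_self]; simp [hasDerivWithinAt_iff_tendsto_slope]
  rw [← Icc_union_Icc_eq_Icc hs.1 hs.2]
  exact hl.union hr

/-- Mean value inequality along a segment. -/
theorem abs_segm_sub_sub_le {V : PSpace d ℓ → ℝ} (hV : ∀ m, AdmitsLinDeriv V m)
    (μ ν : PSpace d ℓ) {c B : ℝ} (hB : ∀ r ∈ Icc (0 : ℝ) 1, |segmSlope V μ ν r - c| ≤ B) {s : ℝ}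
    (hs : s ∈ Icc (0 : ℝ) 1) : |V (segm μ ν s) - V μ - s * c| ≤ B * s := by
  have h := (convex_Icc (0 : ℝ) 1).norm_image_sub_le_of_norm_hasDerivWithin_le
    (f := fun t => V (segm μ ν t) - t * c)
    (fun r hr => (hasDerivWithinAt_segm hV μ ν hr).sub
      ((hasDerivWithinAt_id r _).mul_const c)) (C := B)
    (fun r hr => by simpa using hB r hr) ⟨le_rfl, zero_le_one⟩ hs
  simpa [segm_zero, abs_of_nonneg hs.1, sub_right_comm] using h

/-! ### Empirical measures and their interpolation with the law -/

theorem empirical_meas (x : ℕ → E d) {n : ℕ} (hn : n ≠ 0) :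
    (empirical ℓ x n).meas = (n : ℝ≥0∞)⁻¹ • ∑ i ∈ Finset.range n, Measure.dirac (x i) := by
  rw [empirical, dif_neg hn]

theorem integrable_empirical (x : ℕ → E d) (n : ℕ) (g : E d → ℝ) :
    Integrable g (empirical ℓ x n).meas := by
  rcases eq_or_ne n 0 with rfl | hn
  · simpa [empirical, diracP] using integrable_dirac (by simp)
  · rw [empirical_meas x hn]
    exact (integrable_finsetSum_measure.2 fun _ _ => integrable_dirac (by simp)).smul_measure
      (ENNReal.inv_ne_top.2 (Nat.cast_ne_zero.2 hn))

theorem integral_empirical (x : ℕ → E d) {n : ℕ} (hn : n ≠ 0) (g : E d → ℝ) :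
    ∫ y, g y ∂(empirical ℓ x n).meas = (n : ℝ)⁻¹ * ∑ i ∈ Finset.range n, g (x i) := by
  rw [empirical_meas x hn, integral_smul_measure,
    integral_finsetSum_measure fun _ _ => integrable_dirac (by simp)]
  simp

theorem empirical_congr {x x' : ℕ → E d} {n : ℕ} (h : ∀ i < n, x i = x' i) :
    empirical ℓ x n = empirical ℓ x' n := by
  rcases eq_or_ne n 0 with rfl | hn
  · simp [empirical]
  · refine PSpace.ext_meas ?_
    rw [empirical_meas x hn, empirical_meas x' hn]
    congr 1
    exact Finset.sum_congr rfl fun i hi => by rw [h i (Finset.mem_range.1 hi)]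

/-- The interpolation `(1/N) ∑_{i<n} δ_{x_i} + (1 - n/N) m₀` between `m₀` and the empirical
measure. -/
noncomputable def interp (m₀ : PSpace d ℓ) (N n : ℕ) (x : ℕ → E d) : PSpace d ℓ :=
  segm m₀ (empirical ℓ x n) (n / N)

theorem ratio_mem {N n : ℕ} (h : n ≤ N) : (n / N : ℝ) ∈ Icc (0 : ℝ) 1 :=
  ⟨by positivity, div_le_one_of_le₀ (by exact_mod_cast h) (by positivity)⟩

theorem interp_zero (m₀ : PSpace d ℓ) (N : ℕ) (x : ℕ → E d) : interp m₀ N 0 x = m₀ := by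
  simp [interp, segm_zero]

theorem interp_self (m₀ : PSpace d ℓ) {N : ℕ} (hN : N ≠ 0) (x : ℕ → E d) :
    interp m₀ N N x = empirical ℓ x N := by
  rw [interp, div_self (Nat.cast_ne_zero.2 hN), segm_one]

theorem interp_congr (m₀ : PSpace d ℓ) (N : ℕ) {x x' : ℕ → E d} {n : ℕ}
    (h : ∀ i < n, x i = x' i) : interp m₀ N n x = interp m₀ N n x' := by
  rw [interp, interp, empirical_congr h]

theorem integral_interp (m₀ : PSpace d ℓ) {N n : ℕ} (hN : N ≠ 0) (hn : n ≤ N) (x : ℕ → E d)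
    {g : E d → ℝ} (hg : Integrable g m₀.meas) :
    ∫ y, g y ∂(interp m₀ N n x).meas =
      (1 - n / N) * ∫ y, g y ∂m₀.meas + (N : ℝ)⁻¹ * ∑ i ∈ Finset.range n, g (x i) := by
  rw [interp, integral_segm _ _ (ratio_mem hn) hg (integrable_empirical _ _ _)]
  rcases eq_or_ne n 0 with rfl | hn
  · simp
  · rw [integral_empirical x hn]
    have : (n : ℝ) ≠ 0 := Nat.cast_ne_zero.2 hn
    field_simp

/-- Filling the missing mass with `m₀` makes each increment centred. This is the source of the
martingale structure. -/
theorem integral_interp_succ_sub (m₀ : PSpace d ℓ) {N n : ℕ} (hn : n < N) (x : ℕ → E d)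
    {g : E d → ℝ} (hg : Integrable g m₀.meas) :
    ∫ y, g y ∂(interp m₀ N (n + 1) x).meas - ∫ y, g y ∂(interp m₀ N n x).meas =
      (N : ℝ)⁻¹ * (g (x n) - ∫ y, g y ∂m₀.meas) := by
  have hN : N ≠ 0 := by omega
  rw [integral_interp m₀ hN hn x hg, integral_interp m₀ hN hn.le x hg, Finset.sum_range_succ]
  push_cast
  ring

/-! ### Growth bounds on the first two derivatives -/

/-- The weight `1 + |x|^{ℓ/2}`. -/
noncomputable def wt (ℓ : ℝ) (x : E d) : ℝ := 1 + ‖x‖ ^ (ℓ / 2)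

theorem one_le_wt (x : E d) : 1 ≤ wt ℓ x :=
  le_add_of_nonneg_right (by positivity)

theorem rpow_half_sq (x : E d) : (‖x‖ ^ (ℓ / 2)) ^ 2 = ‖x‖ ^ ℓ := by
  rw [← Real.rpow_natCast, ← Real.rpow_mul (norm_nonneg x)]
  congr 1
  push_cast
  ring

theorem wt_sq_le (x : E d) : wt ℓ x ^ 2 ≤ 2 * (1 + ‖x‖ ^ ℓ) := by
  rw [wt, ← rpow_half_sq (ℓ := ℓ)]
  nlinarith [sq_nonneg (1 - ‖x‖ ^ (ℓ / 2))]

theorem wt_le (x : E d) : wt ℓ x ≤ 2 + ‖x‖ ^ ℓ := by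
  rw [wt, ← rpow_half_sq (ℓ := ℓ)]
  nlinarith [sq_nonneg (1 - ‖x‖ ^ (ℓ / 2))]

theorem measurable_wt : Measurable (wt ℓ : E d → ℝ) := by
  unfold wt
  fun_prop

/-- The quantitative regularity of `U` that the central limit theorem uses. -/
structure Regular (U : PSpace d ℓ → ℝ) (C : ℝ) : Prop where
  pos : 0 < C
  admits : ∀ μ, AdmitsLinDeriv U μ
  admits_linDeriv : ∀ x μ, AdmitsLinDeriv (fun m => linDeriv U m x) μ
  abs_le : ∀ μ x, |linDeriv U μ x| ≤ C * wt ℓ x * (1 + √μ.moment)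
  abs_le_two : ∀ μ x y,
    |linDeriv (fun m => linDeriv U m x) μ y| ≤ C * (wt ℓ x + ‖y‖ ^ ℓ + μ.moment)

theorem exists_regular {U : PSpace d ℓ → ℝ} (hU₁ : ClassS 1 (ℓ / 2) U)
    (hU₂ : ClassS 2 ℓ U)
    (hU : ∃ C : ℝ, ∀ (μ : PSpace d ℓ) (x y : E d),
      |iterLinDeriv U 2 μ ![x, y]| ≤ C * (1 + ‖x‖ ^ (ℓ / 2) + ‖y‖ ^ ℓ + μ.moment)) :
    ∃ C, Regular U C := by
  obtain ⟨-, -, C₁, h₁⟩ := hU₁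
  obtain ⟨C₂, h₂⟩ := hU
  refine ⟨max 1 (max C₁ C₂), ⟨by positivity, fun μ => hU₂.1 0 (by norm_num) ![] μ,
    fun x μ => hU₂.1 1 (by norm_num) ![x] μ, fun μ x => ?_, fun μ x y => ?_⟩⟩
  · refine (h₁ 1 le_rfl le_rfl μ ![x]).trans ?_
    -- For `ℓ > 0` the exponent `(ℓ/2)/ℓ` is `1/2`; for `ℓ = 0` the moment term is absent.
    have hm : (if 0 < ℓ then μ.moment ^ (ℓ / 2 / ℓ) else 0) ≤ √μ.moment := by
      split_ifs with h
      · rw [Real.sqrt_eq_rpow, div_right_comm, div_self h.ne']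
      · positivity
    have hm0 : 0 ≤ (if 0 < ℓ then μ.moment ^ (ℓ / 2 / ℓ) else 0) := by
      have := μ.moment_nonneg
      split_ifs <;> positivity
    have hx : 0 ≤ ‖x‖ ^ (ℓ / 2) := by positivity
    simp only [Finset.univ_unique, Finset.sum_singleton, Matrix.cons_val_fin_one]
    rw [mul_assoc]
    refine mul_le_mul ((le_max_left _ _).trans (le_max_right _ _)) ?_ (by positivity)
      (by positivity)
    rw [wt]
    -- The additive bound passes to a product through `1 + a + b ≤ (1 + a)(1 + b)`.
    nlinarith [mul_nonneg hx (Real.sqrt_nonneg μ.moment)]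
  · refine (h₂ μ x y).trans ?_
    rw [wt]
    have := μ.moment_nonneg
    gcongr
    exact (le_max_right _ _).trans (le_max_right _ _)

/-! ### Oscillation of the derivative and second order expansion -/

/-- The distance of `ν` and `m₀` in total variation weighted by `1 + |y|^ℓ`. -/
noncomputable def disc (m₀ ν : PSpace d ℓ) : ℝ :=
  sSup {r | ∃ g : E d → ℝ, Measurable g ∧ (∀ y, |g y| ≤ 1 + ‖y‖ ^ ℓ) ∧
    r = |∫ y, g y ∂ν.meas - ∫ y, g y ∂m₀.meas|}

theorem PSpace.abs_integral_le (μ : PSpace d ℓ) {g : E d → ℝ} {a b : ℝ}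
    (h : ∀ y, |g y| ≤ a + b * ‖y‖ ^ ℓ) : |∫ y, g y ∂μ.meas| ≤ a + b * μ.moment := by
  refine (norm_integral_le_of_norm_le (f := g) ((integrable_const a).add (μ.integrable_moment.const_mul b))
    (ae_of_all _ h)).trans_eq ?_
  simp only [Pi.add_apply]
  rw [integral_add (integrable_const a) (μ.integrable_moment.const_mul b), integral_const_mul]
  simp [PSpace.moment]

theorem abs_integral_sub_le_disc (m₀ ν : PSpace d ℓ) {g : E d → ℝ} (hg : Measurable g)
    (h : ∀ y, |g y| ≤ 1 + ‖y‖ ^ ℓ) :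
    |∫ y, g y ∂ν.meas - ∫ y, g y ∂m₀.meas| ≤ disc m₀ ν := by
  -- The real supremum is meaningful only for a bounded set; the two moments supply the bound.
  refine le_csSup ⟨(1 + ν.moment) + (1 + m₀.moment), ?_⟩ ⟨g, hg, h, rfl⟩
  rintro _ ⟨g, -, hg, rfl⟩
  refine (abs_sub _ _).trans (add_le_add ?_ ?_)
  · simpa using ν.abs_integral_le (a := 1) (b := 1) (by simpa using hg)
  · simpa using m₀.abs_integral_le (a := 1) (b := 1) (by simpa using hg)

theorem abs_integral_sub_le_mul_disc (m₀ ν : PSpace d ℓ) {g : E d → ℝ} (hg : Measurable g) {K : ℝ}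
    (hK : 0 < K) (h : ∀ y, |g y| ≤ K * (1 + ‖y‖ ^ ℓ)) :
    |∫ y, g y ∂ν.meas - ∫ y, g y ∂m₀.meas| ≤ K * disc m₀ ν := by
  have := abs_integral_sub_le_disc m₀ ν (hg.const_mul K⁻¹) fun y => by
    rw [abs_mul, abs_inv, abs_of_pos hK, inv_mul_le_iff₀ hK]
    exact h y
  rw [integral_const_mul, integral_const_mul, ← mul_sub, abs_mul, abs_inv, abs_of_pos hK,
    inv_mul_le_iff₀ hK] at this
  exact this

theorem disc_nonneg (m₀ ν : PSpace d ℓ) : 0 ≤ disc m₀ ν :=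
  (abs_nonneg _).trans (abs_integral_sub_le_disc m₀ ν (g := fun _ => 0) measurable_const
    fun y => by rw [abs_zero]; positivity)

theorem disc_le (m₀ ν : PSpace d ℓ) {K : ℝ}
    (h : ∀ g : E d → ℝ, Measurable g → (∀ y, |g y| ≤ 1 + ‖y‖ ^ ℓ) →
      |∫ y, g y ∂ν.meas - ∫ y, g y ∂m₀.meas| ≤ K) : disc m₀ ν ≤ K := by
  refine csSup_le ⟨_, fun _ => 0, measurable_const, fun y => by rw [abs_zero]; positivity, rfl⟩ ?_
  rintro _ ⟨g, h1, h2, rfl⟩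
  exact h g h1 h2

/-- The majorant of the squared oscillation of `δU/δm` between `m₀` and `ν`. -/
noncomputable def oscSq (m₀ ν : PSpace d ℓ) : ℝ :=
  min (((1 + (m₀.moment + ν.moment)) * disc m₀ ν) ^ 2) (8 * (1 + (m₀.moment + ν.moment)))

theorem oscSq_nonneg (m₀ ν : PSpace d ℓ) : 0 ≤ oscSq m₀ ν :=
  le_min (sq_nonneg _) (by linarith [m₀.moment_nonneg, ν.moment_nonneg])

/-- Two bounds compete. The mean value inequality integrates `δ²U/δm²` against `ν - m₀` and is small
when `ν` is close to `m₀`; the growth of `δU/δm` at both points gives a square that is merely linear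
in the moments, hence integrable under sampling. The bound is uniform in `s`. -/
theorem Regular.abs_linDeriv_segm_sub_le {U : PSpace d ℓ → ℝ} {C : ℝ} (hU : Regular U C)
    (m₀ ν : PSpace d ℓ) {s : ℝ} (hs : s ∈ Icc (0 : ℝ) 1) (y : E d) :
    |linDeriv U (segm m₀ ν s) y - linDeriv U m₀ y| ≤ C * wt ℓ y * √(oscSq m₀ ν) := by
  have hC := hU.pos
  have hw := one_le_wt (ℓ := ℓ) y
  have hm := m₀.moment_nonneg
  have hn := ν.moment_nonneg
  set M := m₀.moment + ν.moment with hM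
  have hM0 : 0 ≤ M := by positivity
  have h1 : |linDeriv U (segm m₀ ν s) y - linDeriv U m₀ y| ≤
      C * wt ℓ y * ((1 + M) * disc m₀ ν) := by
    have hB : ∀ r ∈ Icc (0 : ℝ) 1, |segmSlope (fun m => linDeriv U m y) m₀ ν r - 0| ≤
        C * wt ℓ y * ((1 + M) * disc m₀ ν) := by
      intro r hr
      rw [sub_zero, segmSlope]
      refine (abs_integral_sub_le_mul_disc m₀ ν (hU.admits_linDeriv y _).measurable_linDeriv
        -- Since `wt ≥ 1`, `wt y + |z|^ℓ + M ≤ wt y (1 + M)(1 + |z|^ℓ)`.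
        (K := C * (wt ℓ y * (1 + M))) (by positivity) fun z => ?_).trans_eq (by ring)
      refine (hU.abs_le_two _ y z).trans ?_
      have hz : 0 ≤ ‖z‖ ^ ℓ := by positivity
      have := moment_segm_le m₀ ν hr
      rw [mul_assoc]
      gcongr
      have e1 : M ≤ wt ℓ y * M := le_mul_of_one_le_left hM0 hw
      have e2 : ‖z‖ ^ ℓ ≤ wt ℓ y * (1 + M) * ‖z‖ ^ ℓ :=
        le_mul_of_one_le_left hz (by nlinarith)
      linarith
    have := abs_segm_sub_sub_le (hU.admits_linDeriv y) m₀ ν hB hs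
    rw [mul_zero, sub_zero] at this
    refine this.trans (mul_le_of_le_one_right ?_ hs.2)
    have := disc_nonneg m₀ ν
    positivity
  have h2 : |linDeriv U (segm m₀ ν s) y - linDeriv U m₀ y| ≤
      C * wt ℓ y * √(8 * (1 + M)) := by
    have e1 : √(segm m₀ ν s).moment ≤ √M := Real.sqrt_le_sqrt (moment_segm_le m₀ ν hs)
    have e2 : √m₀.moment ≤ √M := Real.sqrt_le_sqrt (by linarith)
    -- The `8` in `oscSq` comes from `4 (1 + √M)² ≤ 8 (1 + M)`.
    have e3 : 2 * (1 + √M) ≤ √(8 * (1 + M)) := by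
      apply Real.le_sqrt_of_sq_le
      nlinarith [Real.sq_sqrt hM0, sq_nonneg (1 - √M)]
    calc _ ≤ _ := abs_sub _ _
      _ ≤ C * wt ℓ y * (1 + √M) + C * wt ℓ y * (1 + √M) := by
        refine add_le_add ((hU.abs_le _ y).trans ?_) ((hU.abs_le _ y).trans ?_) <;> gcongr
      _ = C * wt ℓ y * (2 * (1 + √M)) := by ring
      _ ≤ _ := by gcongr
  have hd : 0 ≤ (1 + M) * disc m₀ ν := mul_nonneg (by linarith) (disc_nonneg _ _)
  rw [oscSq, Monotone.map_min (f := Real.sqrt) fun _ _ h => Real.sqrt_le_sqrt h, Real.sqrt_sq hd, mul_min_of_nonneg _ _ (by positivity)]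
  exact le_min h1 h2

/-- Two applications of the mean value inequality, each giving a factor `c` because `ν - μ = c (δ_z
- m₀)`: one for `δU/δm(·, y)`, whose oscillation along the segment is `O(c)`, and one for `U`, whose
slope differs from its initial value by `c` times such oscillations. -/
theorem Regular.abs_sub_sub_le {U : PSpace d ℓ → ℝ} {C : ℝ} (hU : Regular U C)
    (m₀ μ ν : PSpace d ℓ) (z : E d) {c : ℝ} (hc : 0 ≤ c)
    (h : ∀ g : E d → ℝ, (∀ ρ : PSpace d ℓ, Integrable g ρ.meas) →
      ∫ y, g y ∂ν.meas - ∫ y, g y ∂μ.meas = c * (g z - ∫ y, g y ∂m₀.meas)) :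
    |U ν - U μ - c * (linDeriv U μ z - ∫ y, linDeriv U μ y ∂m₀.meas)| ≤
      8 * C * c ^ 2 * (1 + ‖z‖ ^ ℓ + m₀.moment + (μ.moment + ν.moment)) := by
  have hC := hU.pos
  have hμ := μ.moment_nonneg
  have hν := ν.moment_nonneg
  have hm := m₀.moment_nonneg
  have hz : 0 ≤ ‖z‖ ^ ℓ := by positivity
  set M := μ.moment + ν.moment with hM
  set A := 4 + ‖z‖ ^ ℓ + m₀.moment + 2 * M with hA
  have hA0 : 0 ≤ A := by positivity
  have osc : ∀ s ∈ Icc (0 : ℝ) 1, ∀ y, |linDeriv U (segm μ ν s) y - linDeriv U μ y| ≤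
      c * C * A + c * C * 2 * ‖y‖ ^ ℓ := by
    intro s hs y
    have hy : 0 ≤ ‖y‖ ^ ℓ := by positivity
    have hB : ∀ r ∈ Icc (0 : ℝ) 1, |segmSlope (fun m => linDeriv U m y) μ ν r - 0| ≤
        c * C * A + c * C * 2 * ‖y‖ ^ ℓ := by
      intro r hr
      rw [sub_zero, segmSlope, h _ fun ρ => (hU.admits_linDeriv y _).integrable_linDeriv ρ, abs_mul,
        abs_of_nonneg hc]
      set q := wt ℓ y + (segm μ ν r).moment
      have hq : q ≤ 2 + ‖y‖ ^ ℓ + M := add_le_add (wt_le y) (moment_segm_le μ ν hr)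
      have h1 : |linDeriv (fun m => linDeriv U m y) (segm μ ν r) z| ≤ C * q + C * ‖z‖ ^ ℓ :=
        (hU.abs_le_two _ y z).trans_eq (by ring)
      have h2 : |∫ x, linDeriv (fun m => linDeriv U m y) (segm μ ν r) x ∂m₀.meas| ≤
          C * q + C * m₀.moment :=
        m₀.abs_integral_le fun x => (hU.abs_le_two _ y x).trans_eq (by ring)
      have h3 := (abs_sub _ _).trans (add_le_add h1 h2)
      calc _ ≤ c * (C * q + C * ‖z‖ ^ ℓ + (C * q + C * m₀.moment)) := by gcongr
        _ = c * C * (2 * q + ‖z‖ ^ ℓ + m₀.moment) := by ring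
        _ ≤ c * C * (2 * (2 + ‖y‖ ^ ℓ + M) + ‖z‖ ^ ℓ + m₀.moment) := by gcongr
        _ = _ := by rw [hA]; ring
    have := abs_segm_sub_sub_le (hU.admits_linDeriv y) μ ν hB hs
    rw [mul_zero, sub_zero] at this
    exact this.trans (mul_le_of_le_one_right (by positivity) hs.2)
  have hB : ∀ r ∈ Icc (0 : ℝ) 1,
      |segmSlope U μ ν r - c * (linDeriv U μ z - ∫ y, linDeriv U μ y ∂m₀.meas)| ≤
        8 * C * c ^ 2 * (1 + ‖z‖ ^ ℓ + m₀.moment + M) := by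
    intro r hr
    have i1 := (hU.admits (segm μ ν r)).integrable_linDeriv m₀
    have i2 := (hU.admits μ).integrable_linDeriv m₀
    rw [segmSlope, h _ fun ρ => (hU.admits _).integrable_linDeriv ρ, ← mul_sub, abs_mul,
      abs_of_nonneg hc]
    have e : linDeriv U (segm μ ν r) z - ∫ y, linDeriv U (segm μ ν r) y ∂m₀.meas -
        (linDeriv U μ z - ∫ y, linDeriv U μ y ∂m₀.meas) =
        (linDeriv U (segm μ ν r) z - linDeriv U μ z) -
          ∫ y, (linDeriv U (segm μ ν r) y - linDeriv U μ y) ∂m₀.meas := by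
      rw [integral_sub i1 i2]; ring
    rw [e]
    have h3 := (abs_sub _ _).trans
      (add_le_add (osc r hr z) (m₀.abs_integral_le (osc r hr)))
    calc _ ≤ c * _ := mul_le_mul_of_nonneg_left h3 hc
      _ = C * c ^ 2 * (2 * A + 2 * ‖z‖ ^ ℓ + 2 * m₀.moment) := by ring
      _ ≤ C * c ^ 2 * (8 * (1 + ‖z‖ ^ ℓ + m₀.moment + M)) := by
        gcongr
        have : 0 ≤ M := by positivity
        rw [hA]; linarith
      _ = _ := by ring
  have := abs_segm_sub_sub_le hU.admits μ ν hB (s := 1) ⟨zero_le_one, le_rfl⟩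
  simpa [segm_one] using this

/-! ### Measurability, independence and orthogonality for discrete samples -/

/-- Every function on a countable set with measurable singletons is measurable. This stands in for
the missing regularity of `U` and its derivatives in the measure argument. -/
theorem aemeasurable_of_countable {β γ : Type*} [MeasurableSpace β] [MeasurableSingletonClass β]
    [MeasurableSpace γ] {μ : Measure β} {T : Set β} (hT : T.Countable) (h : ∀ᵐ x ∂μ, x ∈ T)
    (F : β → γ) : AEMeasurable F μ := by
  rw [← Measure.restrict_eq_self_of_ae_mem h,
    aemeasurable_restrict_iff_comap_subtype hT.measurableSet]
  have := hT.to_subtype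
  exact Measurable.of_discrete.aemeasurable

/-- The sequence `x` with all terms from the `n`-th on replaced by `0`. -/
def trunc (n : ℕ) (x : ℕ → E d) (k : ℕ) : E d := if k < n then x k else 0

theorem trunc_of_lt {n k : ℕ} (h : k < n) (x : ℕ → E d) : trunc n x k = x k := if_pos h

theorem trunc_trunc {k n : ℕ} (h : k ≤ n) (x : ℕ → E d) : trunc k (trunc n x) = trunc k x := by
  funext i
  simp only [trunc]
  split_ifs <;> first | rfl | omega

theorem measurable_trunc (n : ℕ) : Measurable (trunc n : (ℕ → E d) → ℕ → E d) := by
  refine measurable_pi_lambda _ fun k => ?_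
  by_cases h : k < n
  · simpa only [trunc, if_pos h] using measurable_pi_apply k
  · simp only [trunc, if_neg h, measurable_const]

/-- A truncated sequence is determined by finitely many entries of a countable set; whole sequences
could form an uncountable set. -/
theorem countable_trunc {S : Set (E d)} (hS : S.Countable) (n : ℕ) :
    (trunc n '' {x : ℕ → E d | ∀ k, x k ∈ S}).Countable := by
  have := hS.to_subtype
  refine (countable_range fun s : Fin n → S =>
    fun k : ℕ => if h : k < n then (s ⟨k, h⟩ : E d) else 0).mono ?_
  rintro _ ⟨x, hx, rfl⟩
  exact ⟨fun k => ⟨x k, hx k⟩, by funext k; simp [trunc]⟩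

variable {Ω : Type*} [MeasurableSpace Ω] {P : Measure Ω}

/-- `ζ` is an i.i.d. sequence with law `m₀`, which is carried by the countable set `S`. -/
structure Sampling (m₀ : PSpace d ℓ) (S : Set (E d)) (ζ : ℕ → Ω → E d) (P : Measure Ω) : Prop where
  meas : ∀ i, Measurable (ζ i)
  indep : iIndepFun ζ P
  law : ∀ i, P.map (ζ i) = m₀.meas
  countable : S.Countable
  carried : m₀.meas S = 1

namespace Sampling

variable {m₀ : PSpace d ℓ} {S : Set (E d)} {ζ : ℕ → Ω → E d}

theorem ae_mem (h : Sampling m₀ S ζ P) : ∀ᵐ y ∂m₀.meas, y ∈ S :=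
  (prob_compl_eq_zero_iff h.countable.measurableSet).2 h.carried

theorem ae_forall_mem (h : Sampling m₀ S ζ P) : ∀ᵐ ω ∂P, ∀ i, ζ i ω ∈ S :=
  ae_all_iff.2 fun i => ae_of_ae_map (h.meas i).aemeasurable (by rw [h.law i]; exact h.ae_mem)

theorem measurable_past (h : Sampling m₀ S ζ P) (n : ℕ) :
    Measurable fun ω => trunc n (fun k => ζ k ω) :=
  (measurable_trunc n).comp (measurable_pi_lambda _ h.meas)

theorem ae_past_mem (h : Sampling m₀ S ζ P) (n : ℕ) :
    ∀ᵐ ω ∂P, trunc n (fun k => ζ k ω) ∈ trunc n '' {x : ℕ → E d | ∀ k, x k ∈ S} := by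
  filter_upwards [h.ae_forall_mem] with ω hω
  exact ⟨_, hω, rfl⟩

theorem aemeasurable_map_past (h : Sampling m₀ S ζ P) (n : ℕ) (F : (ℕ → E d) → ℝ) :
    AEMeasurable F (P.map fun ω => trunc n (fun k => ζ k ω)) :=
  aemeasurable_of_countable (countable_trunc h.countable n)
    ((ae_map_iff (h.measurable_past n).aemeasurable
      (countable_trunc h.countable n).measurableSet).2 (h.ae_past_mem n)) F

theorem aemeasurable_past (h : Sampling m₀ S ζ P) (n : ℕ) (F : (ℕ → E d) → ℝ) :
    AEMeasurable (fun ω => F (trunc n (fun k => ζ k ω))) P :=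
  (h.aemeasurable_map_past n F).comp_measurable (h.measurable_past n)

theorem aemeasurable_of_eq_past (h : Sampling m₀ S ζ P) (n : ℕ) {F : (ℕ → E d) → ℝ}
    (hF : ∀ x, F (trunc n x) = F x) : AEMeasurable (fun ω => F (fun k => ζ k ω)) P := by
  simpa only [hF] using h.aemeasurable_past n F

theorem aemeasurable_pair (h : Sampling m₀ S ζ P) (n : ℕ) (F : (ℕ → E d) → E d → ℝ) :
    AEMeasurable (fun ω => F (trunc n (fun k => ζ k ω)) (ζ n ω)) P :=
  h.aemeasurable_of_eq_past (n + 1) (F := fun x => F (trunc n x) (x n)) fun x => by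
    rw [trunc_trunc (Nat.le_succ n), trunc_of_lt (Nat.lt_succ_self n)]

theorem indepFun_past (h : Sampling m₀ S ζ P) (n : ℕ) :
    IndepFun (fun ω => trunc n (fun k => ζ k ω)) (ζ n) P := by
  have h1 := h.indep.indepFun_finset (Finset.range n) {n} (by simp) h.meas
  have hφ : Measurable fun (s : Finset.range n → E d) (k : ℕ) =>
      if hk : k < n then s ⟨k, Finset.mem_range.2 hk⟩ else 0 := by
    refine measurable_pi_lambda _ fun k => ?_
    by_cases hk : k < n
    · simpa only [dif_pos hk] using measurable_pi_apply _
    · simp only [dif_neg hk, measurable_const]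
  have h2 := h1.comp hφ (measurable_pi_apply (⟨n, Finset.mem_singleton_self n⟩ : ({n} : Finset ℕ)))
  convert! h2 using 1

theorem identDistrib (h : Sampling m₀ S ζ P) {g : E d → ℝ} (hg : Measurable g) (i : ℕ) :
    IdentDistrib (fun ω => g (ζ i ω)) (fun ω => g (ζ 0 ω)) P P :=
  IdentDistrib.comp ⟨(h.meas i).aemeasurable, (h.meas 0).aemeasurable, by rw [h.law, h.law]⟩ hg

theorem integral_comp (h : Sampling m₀ S ζ P) {g : E d → ℝ} (hg : Measurable g) (i : ℕ) :
    ∫ ω, g (ζ i ω) ∂P = ∫ y, g y ∂m₀.meas := by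
  rw [← h.law i, integral_map (h.meas i).aemeasurable hg.aestronglyMeasurable]

theorem integrable_comp (h : Sampling m₀ S ζ P) {g : E d → ℝ} (hg : Integrable g m₀.meas) (i : ℕ) :
    Integrable (fun ω => g (ζ i ω)) P := by
  rw [← h.law i] at hg
  exact hg.comp_measurable (h.meas i)

theorem pairwise_indepFun (h : Sampling m₀ S ζ P) {g : E d → ℝ} (hg : Measurable g) :
    Pairwise fun i j => IndepFun (fun ω => g (ζ i ω)) (fun ω => g (ζ j ω)) P :=
  fun _ _ hij => (h.indep.indepFun hij).comp hg hg

theorem ae_tendsto_integral_empirical (h : Sampling m₀ S ζ P) {g : E d → ℝ} (hg : Measurable g)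
    (hi : Integrable g m₀.meas) :
    ∀ᵐ ω ∂P, Tendsto (fun n => ∫ y, g y ∂(empirical ℓ (fun k => ζ k ω) n).meas) atTop
      (𝓝 (∫ y, g y ∂m₀.meas)) := by
  have := strong_law_ae_real (fun i ω => g (ζ i ω)) (h.integrable_comp hi 0)
    (h.pairwise_indepFun hg) (h.identDistrib hg)
  filter_upwards [this] with ω hω
  rw [h.integral_comp hg] at hω
  refine hω.congr' ?_
  filter_upwards [eventually_ne_atTop 0] with n hn
  rw [integral_empirical _ hn, div_eq_inv_mul]

theorem integral_past_mul (h : Sampling m₀ S ζ P) (n : ℕ) (F : (ℕ → E d) → ℝ) {g : E d → ℝ}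
    (hg : Measurable g) :
    ∫ ω, F (trunc n (fun k => ζ k ω)) * g (ζ n ω) ∂P =
      (∫ ω, F (trunc n (fun k => ζ k ω)) ∂P) * ∫ y, g y ∂m₀.meas := by
  have h1 := (h.indepFun_past n).comp₀ (h.measurable_past n).aemeasurable (h.meas n).aemeasurable
    (h.aemeasurable_map_past n F) hg.aemeasurable
  rw [← h.integral_comp hg n]
  exact h1.integral_fun_mul_eq_mul_integral (h.aemeasurable_past n F).aestronglyMeasurable
    (hg.comp (h.meas n)).aestronglyMeasurable

theorem integrable_past_mul (h : Sampling m₀ S ζ P) (n : ℕ) (F : (ℕ → E d) → ℝ) {g : E d → ℝ}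
    (hg : Measurable g) (hF : Integrable (fun ω => F (trunc n (fun k => ζ k ω))) P)
    (hi : Integrable g m₀.meas) :
    Integrable (fun ω => F (trunc n (fun k => ζ k ω)) * g (ζ n ω)) P :=
  ((h.indepFun_past n).comp₀ (h.measurable_past n).aemeasurable (h.meas n).aemeasurable
    (h.aemeasurable_map_past n F) hg.aemeasurable).integrable_mul hF (h.integrable_comp hi n)

section Orthogonality

variable [IsProbabilityMeasure P]

/-- The past and the new sample have a product joint law, so Fubini integrates out the new sample
first. This replaces conditioning on the past. -/
theorem integral_pair_eq_zero (h : Sampling m₀ S ζ P) (n : ℕ) (F : (ℕ → E d) → E d → ℝ)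
    (hF : ∀ x, ∫ y, F x y ∂m₀.meas = 0)
    (hi : Integrable (fun ω => F (trunc n (fun k => ζ k ω)) (ζ n ω)) P) :
    ∫ ω, F (trunc n (fun k => ζ k ω)) (ζ n ω) ∂P = 0 := by
  set X := fun ω => trunc n (fun k => ζ k ω) with hX
  have hpair : Measurable fun ω => (X ω, ζ n ω) := (h.measurable_past n).prodMk (h.meas n)
  have hlaw : P.map (fun ω => (X ω, ζ n ω)) = (P.map X).prod m₀.meas := by
    rw [(indepFun_iff_map_prod_eq_prod_map_map (h.measurable_past n).aemeasurable
      (h.meas n).aemeasurable).1 (h.indepFun_past n), h.law]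
  have hcount := (countable_trunc h.countable n).prod h.countable
  have hmeas : AEMeasurable (fun p : (ℕ → E d) × E d => F p.1 p.2)
      (P.map fun ω => (X ω, ζ n ω)) := by
    refine aemeasurable_of_countable hcount
      ((ae_map_iff hpair.aemeasurable hcount.measurableSet).2 ?_) _
    filter_upwards [h.ae_past_mem n, h.ae_forall_mem] with ω h1 h2
    exact ⟨h1, h2 n⟩
  have hi' := (integrable_map_measure hmeas.aestronglyMeasurable hpair.aemeasurable).2 hi
  have e := integral_map hpair.aemeasurable hmeas.aestronglyMeasurable
  rw [hlaw] at e hi'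
  rw [← e, integral_prod _ hi']
  simp [hF]

/-- Pythagoras for martingale increments: in the square of the sum, the new term is centred given
the earlier ones, and the cross term vanishes. -/
theorem integral_sq_sum_eq (h : Sampling m₀ S ζ P) (φ : ℕ → (ℕ → E d) → E d → ℝ)
    (hφ : ∀ n x, ∫ y, φ n x y ∂m₀.meas = 0) (N : ℕ)
    (hL : ∀ n < N, MemLp (fun ω => φ n (trunc n (fun k => ζ k ω)) (ζ n ω)) 2 P) :
    ∫ ω, (∑ n ∈ Finset.range N, φ n (trunc n (fun k => ζ k ω)) (ζ n ω)) ^ 2 ∂P =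
      ∑ n ∈ Finset.range N, ∫ ω, φ n (trunc n (fun k => ζ k ω)) (ζ n ω) ^ 2 ∂P := by
  induction N with
  | zero => simp
  | succ N ih =>
    have hM : MemLp (fun ω => ∑ n ∈ Finset.range N, φ n (trunc n (fun k => ζ k ω)) (ζ n ω)) 2 P :=
      memLp_finsetSum _ fun n hn => hL n (by have := Finset.mem_range.1 hn; omega)
    have hN := hL N (Nat.lt_succ_self N)
    have hcross : Integrable (fun ω => (∑ n ∈ Finset.range N,
        φ n (trunc n (fun k => ζ k ω)) (ζ n ω)) * φ N (trunc N (fun k => ζ k ω)) (ζ N ω)) P :=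
      hM.integrable_mul hN
    have hzero : ∫ ω, (∑ n ∈ Finset.range N,
        φ n (trunc n (fun k => ζ k ω)) (ζ n ω)) * φ N (trunc N (fun k => ζ k ω)) (ζ N ω) ∂P = 0 := by
      -- The partial sum is rewritten as a function of the past truncated at `N`, the form to which
      -- `integral_pair_eq_zero` applies.
      have e : ∀ ω, ∑ n ∈ Finset.range N, φ n (trunc n (fun k => ζ k ω)) (ζ n ω) =
          ∑ n ∈ Finset.range N, φ n (trunc n (trunc N fun k => ζ k ω))
            (trunc N (fun k => ζ k ω) n) := fun ω =>
        Finset.sum_congr rfl fun n hn => by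
          rw [trunc_trunc (Finset.mem_range.1 hn).le, trunc_of_lt (Finset.mem_range.1 hn)]
      simp only [e] at hcross ⊢
      exact h.integral_pair_eq_zero N
        (fun x y => (∑ n ∈ Finset.range N, φ n (trunc n x) (x n)) * φ N x y)
        (fun x => by rw [integral_const_mul, hφ, mul_zero]) hcross
    simp only [Finset.sum_range_succ, add_sq]
    rw [← ih fun n hn => hL n (by omega), integral_add _ hN.integrable_sq,
      integral_add hM.integrable_sq]
    · simp only [mul_assoc]
      rw [integral_const_mul, hzero]
      ring
    · simpa only [mul_assoc] using hcross.const_mul 2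
    · refine hM.integrable_sq.add ?_
      simpa only [mul_assoc] using hcross.const_mul 2

end Orthogonality

end Sampling

/-! ### Convergence of empirical measures in weighted total variation -/

theorem measurable_growth : Measurable fun y : E d => 1 + ‖y‖ ^ ℓ := by fun_prop

theorem PSpace.integrable_growth (μ : PSpace d ℓ) : Integrable (fun y => 1 + ‖y‖ ^ ℓ) μ.meas :=
  (integrable_const 1).add μ.integrable_moment

/-- A test function is split into its values at the points of `F` and a tail dominated by the
weight; the resulting bound no longer depends on the test function. -/
theorem disc_le_finset (m₀ ν : PSpace d ℓ) (F : Finset (E d)) :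
    disc m₀ ν ≤ ∑ a ∈ F, (1 + ‖a‖ ^ ℓ) * |∫ y, ({a} : Set (E d)).indicator 1 y ∂ν.meas -
        ∫ y, ({a} : Set (E d)).indicator 1 y ∂m₀.meas| +
      (∫ y, (F : Set (E d))ᶜ.indicator (fun y => 1 + ‖y‖ ^ ℓ) y ∂ν.meas +
        ∫ y, (F : Set (E d))ᶜ.indicator (fun y => 1 + ‖y‖ ^ ℓ) y ∂m₀.meas) := by
  classical
  refine disc_le m₀ ν fun g hg hb => ?_
  have hF : MeasurableSet (F : Set (E d))ᶜ := F.measurableSet.compl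
  have dec : ∀ y, g y = ∑ a ∈ F, g a * ({a} : Set (E d)).indicator (1 : E d → ℝ) y +
      (F : Set (E d))ᶜ.indicator g y := by
    intro y
    by_cases hy : y ∈ F
    · rw [Finset.sum_eq_single y (fun b _ hb => by simp [hb.symm]) (by simp [hy])]
      simp [hy]
    · rw [Finset.sum_eq_zero fun a ha => by
        rw [indicator_of_notMem (by rintro rfl; exact hy ha), mul_zero]]
      simp [hy]
  have int : ∀ ρ : PSpace d ℓ, ∫ y, g y ∂ρ.meas =
      ∑ a ∈ F, g a * ∫ y, ({a} : Set (E d)).indicator 1 y ∂ρ.meas +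
        ∫ y, (F : Set (E d))ᶜ.indicator g y ∂ρ.meas := by
    intro ρ
    have hind : ∀ a : E d, Integrable (({a} : Set (E d)).indicator (1 : E d → ℝ)) ρ.meas :=
      fun a => (integrable_const (1 : ℝ)).indicator (measurableSet_singleton a)
    have hgi : Integrable g ρ.meas := ρ.integrable_of_growth hg (C := 1) (by simpa using hb)
    have hsi : ∀ a ∈ F, Integrable
        (fun y => g a * ({a} : Set (E d)).indicator (1 : E d → ℝ) y) ρ.meas :=
      fun a _ => (hind a).const_mul _
    rw [integral_congr_ae (ae_of_all _ dec), integral_add (integrable_finsetSum F hsi) (hgi.indicator hF), integral_finsetSum F hsi]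
    simp only [integral_const_mul]
  have tail : ∀ ρ : PSpace d ℓ, |∫ y, (F : Set (E d))ᶜ.indicator g y ∂ρ.meas| ≤
      ∫ y, (F : Set (E d))ᶜ.indicator (fun y => 1 + ‖y‖ ^ ℓ) y ∂ρ.meas := by
    intro ρ
    refine norm_integral_le_of_norm_le (f := (F : Set (E d))ᶜ.indicator g)
      (ρ.integrable_growth.indicator hF) (ae_of_all _ fun y => ?_)
    rw [norm_indicator_eq_indicator_norm]
    exact indicator_le_indicator (hb y)
  rw [int ν, int m₀, add_sub_add_comm, ← Finset.sum_sub_distrib]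
  refine (abs_add_le _ _).trans (add_le_add ((Finset.abs_sum_le_sum_abs _ _).trans ?_)
    ((abs_sub _ _).trans (add_le_add (tail ν) (tail m₀))))
  refine Finset.sum_le_sum fun a _ => ?_
  rw [← mul_sub, abs_mul]
  exact mul_le_mul_of_nonneg_right (hb a) (abs_nonneg _)

theorem moment_empirical (x : ℕ → E d) {n : ℕ} (hn : n ≠ 0) :
    (empirical ℓ x n).moment = (n : ℝ)⁻¹ * ∑ i ∈ Finset.range n, ‖x i‖ ^ ℓ :=
  integral_empirical x hn _

theorem moment_interp (m₀ : PSpace d ℓ) {N n : ℕ} (hN : N ≠ 0) (hn : n ≤ N) (x : ℕ → E d) :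
    (interp m₀ N n x).moment =
      (1 - n / N) * m₀.moment + (N : ℝ)⁻¹ * ∑ i ∈ Finset.range n, ‖x i‖ ^ ℓ :=
  integral_interp m₀ hN hn x m₀.integrable_moment

namespace Sampling

variable {m₀ : PSpace d ℓ} {S : Set (E d)} {ζ : ℕ → Ω → E d}

/-- Finite sets exhaust the countable carrier, so the weighted tail under `m₀` is small. The strong
law is applied to each atom and each tail, which costs only countably many null sets. For a diffuse
law the statement fails: empirical measures are then singular to `m₀`. -/
theorem ae_tendsto_disc (h : Sampling m₀ S ζ P) :
    ∀ᵐ ω ∂P, Tendsto (fun n => disc m₀ (empirical ℓ (fun k => ζ k ω) n)) atTop (𝓝 0) := by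
  classical
  have hne : S.Nonempty := by
    rw [nonempty_iff_ne_empty]
    rintro rfl
    simpa using h.carried
  obtain ⟨e, he⟩ := h.countable.exists_eq_range hne
  set F : ℕ → Finset (E d) := fun k => (Finset.range k).image e with hFdef
  set tail : ℕ → E d → ℝ := fun k => (F k : Set (E d))ᶜ.indicator fun y => 1 + ‖y‖ ^ ℓ with htail
  have hFm : ∀ k, MeasurableSet (F k : Set (E d))ᶜ := fun k => (F k).measurableSet.compl
  have htm : ∀ k, Measurable (tail k) := fun k => measurable_growth.indicator (hFm k)
  have hti : ∀ k, Integrable (tail k) m₀.meas := fun k => m₀.integrable_growth.indicator (hFm k)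
  have ht : Tendsto (fun k => ∫ y, tail k y ∂m₀.meas) atTop (𝓝 0) := by
    rw [← integral_zero (E d) ℝ (μ := m₀.meas)]
    refine tendsto_integral_of_dominated_convergence (fun y => 1 + ‖y‖ ^ ℓ)
      (fun k => (htm k).aestronglyMeasurable) m₀.integrable_growth
      (fun k => ae_of_all _ fun y => ?_) ?_
    · have hy : 0 ≤ 1 + ‖y‖ ^ ℓ := by positivity
      rw [htail, norm_indicator_eq_indicator_norm]
      exact (indicator_le_self' (fun _ _ => norm_nonneg _) y).trans_eq
        (Real.norm_of_nonneg hy)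
    · filter_upwards [h.ae_mem] with y hy
      rw [he] at hy
      obtain ⟨i, rfl⟩ := hy
      refine tendsto_const_nhds.congr' ?_
      filter_upwards [eventually_gt_atTop i] with k hk
      refine (indicator_of_notMem ?_ _).symm
      rw [mem_compl_iff, not_not]
      exact Finset.mem_coe.2 (Finset.mem_image_of_mem e (Finset.mem_range.2 hk))
  have h1 := ae_all_iff.2 fun k => h.ae_tendsto_integral_empirical (htm k) (hti k)
  have h2 := ae_all_iff.2 fun i => h.ae_tendsto_integral_empirical
    (g := ({e i} : Set (E d)).indicator 1)
    (measurable_one.indicator (measurableSet_singleton _))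
    ((integrable_const (1 : ℝ)).indicator (measurableSet_singleton _))
  filter_upwards [h1, h2] with ω h1 h2
  refine tendsto_order.2 ⟨fun a ha => Eventually.of_forall fun n => ha.trans_le (disc_nonneg _ _),
    fun ε hε => ?_⟩
  -- Half of `ε`, because in the limit the tail counts twice.
  obtain ⟨k, hk⟩ := ((tendsto_order.1 ht).2 (ε / 2) (by positivity)).exists
  have lim : Tendsto (fun n => ∑ a ∈ F k, (1 + ‖a‖ ^ ℓ) *
      |∫ y, ({a} : Set (E d)).indicator 1 y ∂(empirical ℓ (fun k => ζ k ω) n).meas -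
        ∫ y, ({a} : Set (E d)).indicator 1 y ∂m₀.meas| +
      (∫ y, tail k y ∂(empirical ℓ (fun k => ζ k ω) n).meas + ∫ y, tail k y ∂m₀.meas)) atTop
      (𝓝 (∑ a ∈ F k, (1 + ‖a‖ ^ ℓ) * |∫ y, ({a} : Set (E d)).indicator 1 y ∂m₀.meas -
        ∫ y, ({a} : Set (E d)).indicator 1 y ∂m₀.meas| +
      (∫ y, tail k y ∂m₀.meas + ∫ y, tail k y ∂m₀.meas))) := by
    refine (tendsto_finsetSum _ fun a ha => ?_).add ((h1 k).add_const _)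
    obtain ⟨i, -, rfl⟩ := Finset.mem_image.1 ha
    exact (((h2 i).sub_const _).abs).const_mul _
  have hlt : ∑ a ∈ F k, (1 + ‖a‖ ^ ℓ) * |∫ y, ({a} : Set (E d)).indicator 1 y ∂m₀.meas -
        ∫ y, ({a} : Set (E d)).indicator 1 y ∂m₀.meas| +
      (∫ y, tail k y ∂m₀.meas + ∫ y, tail k y ∂m₀.meas) < ε := by
    simp only [sub_self, abs_zero, mul_zero, Finset.sum_const_zero, zero_add]
    linarith
  filter_upwards [(tendsto_order.1 lim).2 ε hlt] with n hn
  exact (disc_le_finset m₀ _ (F k)).trans_lt hn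

theorem integrable_norm_rpow (h : Sampling m₀ S ζ P) (i : ℕ) :
    Integrable (fun ω => ‖ζ i ω‖ ^ ℓ) P :=
  h.integrable_comp m₀.integrable_moment i

theorem integral_norm_rpow (h : Sampling m₀ S ζ P) (i : ℕ) :
    ∫ ω, ‖ζ i ω‖ ^ ℓ ∂P = m₀.moment :=
  h.integral_comp (g := fun y => ‖y‖ ^ ℓ) (by fun_prop) i

/-- The random cap in `oscSq` is replaced by its deterministic limit, so that dominated convergence
becomes available. -/
theorem ae_tendsto_oscSq (h : Sampling m₀ S ζ P) :
    ∀ᵐ ω ∂P, Tendsto (fun n => min (((1 + (m₀.moment +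
      (empirical ℓ (fun k => ζ k ω) n).moment)) * disc m₀ (empirical ℓ (fun k => ζ k ω) n)) ^ 2)
        (8 * (1 + (m₀.moment + m₀.moment)))) atTop (𝓝 0) := by
  filter_upwards [h.ae_tendsto_disc, h.ae_tendsto_integral_empirical (g := fun y => ‖y‖ ^ ℓ)
    (by fun_prop) m₀.integrable_moment] with ω h1 h2
  have h3 := ((((h2.const_add m₀.moment).const_add 1).mul h1).pow 2).min
    (tendsto_const_nhds (x := 8 * (1 + (m₀.moment + m₀.moment))))
  have hm := m₀.moment_nonneg
  rwa [mul_zero, zero_pow two_ne_zero, min_eq_left (by positivity)] at h3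

theorem aemeasurable_empirical (h : Sampling m₀ S ζ P) (F : PSpace d ℓ → ℝ) (n : ℕ) :
    AEMeasurable (fun ω => F (empirical ℓ (fun k => ζ k ω) n)) P :=
  h.aemeasurable_of_eq_past n (F := fun x => F (empirical ℓ x n)) fun x => by
    rw [empirical_congr fun i hi => trunc_of_lt hi x]

section Probability

variable [IsProbabilityMeasure P]

theorem integrable_moment_empirical (h : Sampling m₀ S ζ P) (n : ℕ) :
    Integrable (fun ω => (empirical ℓ (fun k => ζ k ω) n).moment) P := by
  rcases eq_or_ne n 0 with rfl | hn
  · simp [empirical]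
  · simp only [moment_empirical _ hn]
    exact (integrable_finsetSum _ fun i _ => h.integrable_norm_rpow i).const_mul _

theorem integrable_moment_interp (h : Sampling m₀ S ζ P) {N n : ℕ} (hN : N ≠ 0) (hn : n ≤ N) :
    Integrable (fun ω => (interp m₀ N n (fun k => ζ k ω)).moment) P := by
  simp only [moment_interp m₀ hN hn]
  exact (integrable_const _).add
    ((integrable_finsetSum _ fun i _ => h.integrable_norm_rpow i).const_mul _)

theorem integral_moment_interp (h : Sampling m₀ S ζ P) {N n : ℕ} (hN : N ≠ 0) (hn : n ≤ N) :
    ∫ ω, (interp m₀ N n (fun k => ζ k ω)).moment ∂P = m₀.moment := by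
  simp only [moment_interp m₀ hN hn]
  rw [integral_add (integrable_const _)
    ((integrable_finsetSum _ fun i _ => h.integrable_norm_rpow i).const_mul _),
    integral_const_mul, integral_const_mul, integral_finsetSum _ fun i _ => h.integrable_norm_rpow i]
  simp only [h.integral_norm_rpow]
  simp
  field_simp
  ring

theorem tendsto_integral_abs_moment_sub (h : Sampling m₀ S ζ P) :
    Tendsto (fun n => ∫ ω, |(empirical ℓ (fun k => ζ k ω) n).moment - m₀.moment| ∂P) atTop
      (𝓝 0) := by
  have hg : Measurable fun y : E d => ‖y‖ ^ ℓ := by fun_prop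
  have h1 := strong_law_Lp le_rfl ENNReal.one_ne_top (fun i ω => ‖ζ i ω‖ ^ ℓ)
    (memLp_one_iff_integrable.2 (h.integrable_norm_rpow 0))
    (h.pairwise_indepFun hg) (h.identDistrib hg)
  have h2 := (ENNReal.tendsto_toReal ENNReal.zero_ne_top).comp h1
  rw [ENNReal.toReal_zero, h.integral_norm_rpow] at h2
  refine h2.congr' ?_
  filter_upwards [eventually_ne_atTop 0] with n hn
  simp only [Function.comp, eLpNorm_one_eq_lintegral_enorm, smul_eq_mul, ← moment_empirical _ hn]
  exact (integral_norm_eq_lintegral_enorm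
    ((h.integrable_moment_empirical n).sub (integrable_const _)).aestronglyMeasurable).symm

theorem integrable_oscSq (h : Sampling m₀ S ζ P) (n : ℕ) :
    Integrable (fun ω => oscSq m₀ (empirical ℓ (fun k => ζ k ω) n)) P := by
  refine (((integrable_const 1).add ((integrable_const m₀.moment).add
    (h.integrable_moment_empirical n))).const_mul 8).mono'
    (h.aemeasurable_empirical (oscSq m₀) n).aestronglyMeasurable (ae_of_all _ fun ω => ?_)
  rw [Real.norm_of_nonneg (oscSq_nonneg _ _)]
  exact min_le_right _ _

/-- The cap in `oscSq` varies with `n`. Exchanging it for the deterministic one costs at most `8 |m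
- m₀.moment|`, where `m` is the empirical moment, and this vanishes in `L¹` by the `L¹` law of large
numbers. -/
theorem tendsto_integral_oscSq (h : Sampling m₀ S ζ P) :
    Tendsto (fun n => ∫ ω, oscSq m₀ (empirical ℓ (fun k => ζ k ω) n) ∂P) atTop (𝓝 0) := by
  have hm := m₀.moment_nonneg
  set f : ℕ → Ω → ℝ := fun n ω => min (((1 + (m₀.moment +
      (empirical ℓ (fun k => ζ k ω) n).moment)) * disc m₀ (empirical ℓ (fun k => ζ k ω) n)) ^ 2)
        (8 * (1 + (m₀.moment + m₀.moment))) with hf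
  have hfm : ∀ n, AEStronglyMeasurable (f n) P := fun n =>
    (h.aemeasurable_empirical (fun ν => min (((1 + (m₀.moment + ν.moment)) * disc m₀ ν) ^ 2)
      (8 * (1 + (m₀.moment + m₀.moment)))) n).aestronglyMeasurable
  have hfb : ∀ n ω, ‖f n ω‖ ≤ 8 * (1 + (m₀.moment + m₀.moment)) := fun n ω => by
    rw [Real.norm_of_nonneg (le_min (sq_nonneg _) (by positivity))]
    exact min_le_right _ _
  have hfi : ∀ n, Integrable (f n) P := fun n =>
    (integrable_const _).mono' (hfm n) (ae_of_all _ (hfb n))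
  have h1 : Tendsto (fun n => ∫ ω, f n ω ∂P) atTop (𝓝 0) := by
    rw [← integral_zero Ω ℝ (μ := P)]
    exact tendsto_integral_of_dominated_convergence _ hfm (integrable_const _)
      (fun n => ae_of_all _ (hfb n)) h.ae_tendsto_oscSq
  have hdi : ∀ n, Integrable
      (fun ω => 8 * |(empirical ℓ (fun k => ζ k ω) n).moment - m₀.moment|) P := fun n =>
    ((h.integrable_moment_empirical n).sub (integrable_const _)).abs.const_mul 8
  refine squeeze_zero (fun n => integral_nonneg fun ω => oscSq_nonneg _ _) (fun n => ?_)
    (g := fun n => ∫ ω, f n ω ∂P +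
      8 * ∫ ω, |(empirical ℓ (fun k => ζ k ω) n).moment - m₀.moment| ∂P) ?_
  · rw [← integral_const_mul, ← integral_add (hfi n) (hdi n)]
    refine integral_mono (h.integrable_oscSq n) ((hfi n).add (hdi n)) fun ω => ?_
    set m := (empirical ℓ (fun k => ζ k ω) n).moment with hmdef
    have habs := le_abs_self (m - m₀.moment)
    have habs0 := abs_nonneg (m - m₀.moment)
    change oscSq m₀ _ ≤ f n ω + 8 * |m - m₀.moment|
    rw [oscSq, ← min_add_add_right]
    exact min_le_min (by linarith) (by linarith)
  · simpa using h1.add (h.tendsto_integral_abs_moment_sub.const_mul 8)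

end Probability

end Sampling

/-! ### Decomposition of the error -/

theorem PSpace.integrable_wt (μ : PSpace d ℓ) : Integrable (wt ℓ) μ.meas :=
  ((integrable_const 2).add μ.integrable_moment).mono' measurable_wt.aestronglyMeasurable
    (ae_of_all _ fun y => by
      rw [Real.norm_of_nonneg (zero_le_one.trans (one_le_wt y))]
      exact wt_le y)

theorem PSpace.integrable_wt_add_sq (μ : PSpace d ℓ) (c : ℝ) :
    Integrable (fun y => (wt ℓ y + c) ^ 2) μ.meas := by
  have h : Integrable (fun y => wt ℓ y ^ 2) μ.meas :=
    (μ.integrable_growth.const_mul 2).mono' (measurable_wt.pow_const 2).aestronglyMeasurable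
      (ae_of_all _ fun y => by
        rw [Real.norm_of_nonneg (sq_nonneg _)]
        exact wt_sq_le y)
  simp only [add_sq]
  exact (h.add ((μ.integrable_wt.const_mul 2).mul_const c)).add (integrable_const _)

/-- The centred increment of `δU/δm` between `m₀` and the interpolation. -/
noncomputable def fluct (U : PSpace d ℓ → ℝ) (m₀ : PSpace d ℓ) (N n : ℕ) (x : ℕ → E d)
    (y : E d) : ℝ :=
  (linDeriv U (interp m₀ N n x) y - linDeriv U m₀ y) -
    ∫ z, (linDeriv U (interp m₀ N n x) z - linDeriv U m₀ z) ∂m₀.meas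

/-- The second order remainder when the `n`-th sample is added to the interpolation. -/
noncomputable def rem (U : PSpace d ℓ → ℝ) (m₀ : PSpace d ℓ) (N n : ℕ) (x : ℕ → E d) : ℝ :=
  U (interp m₀ N (n + 1) x) - U (interp m₀ N n x) -
    (N : ℝ)⁻¹ * (linDeriv U (interp m₀ N n x) (x n) -
      ∫ y, linDeriv U (interp m₀ N n x) y ∂m₀.meas)

theorem empirical_trunc (n : ℕ) (x : ℕ → E d) : empirical ℓ (trunc n x) n = empirical ℓ x n :=
  empirical_congr fun _ hi => trunc_of_lt hi x

theorem fluct_trunc (U : PSpace d ℓ → ℝ) (m₀ : PSpace d ℓ) (N n : ℕ) (x : ℕ → E d) :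
    fluct U m₀ N n (trunc n x) = fluct U m₀ N n x := by
  funext y
  rw [fluct, fluct, interp_congr m₀ N fun i hi => trunc_of_lt hi x]

theorem rem_trunc (U : PSpace d ℓ → ℝ) (m₀ : PSpace d ℓ) (N n : ℕ) (x : ℕ → E d) :
    rem U m₀ N n (trunc (n + 1) x) = rem U m₀ N n x := by
  rw [rem, rem, interp_congr m₀ N fun i hi => trunc_of_lt hi x,
    interp_congr m₀ N (n := n) fun i hi => trunc_of_lt (hi.trans n.lt_succ_self) x,
    trunc_of_lt n.lt_succ_self]

theorem sub_eq_sum (U : PSpace d ℓ → ℝ) (hU : ∀ μ, AdmitsLinDeriv U μ) (m₀ : PSpace d ℓ) {N : ℕ}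
    (hN : N ≠ 0) (x : ℕ → E d) :
    √(N : ℝ) * (U (empirical ℓ x N) - U m₀) =
      (√(N : ℝ))⁻¹ * ∑ n ∈ Finset.range N, (linDeriv U m₀ (x n) - ∫ y, linDeriv U m₀ y ∂m₀.meas) +
      ((√(N : ℝ))⁻¹ * ∑ n ∈ Finset.range N, fluct U m₀ N n x (x n) +
        √(N : ℝ) * ∑ n ∈ Finset.range N, rem U m₀ N n x) := by
  have hN' : (N : ℝ) ≠ 0 := Nat.cast_ne_zero.2 hN
  have hs : (√(N : ℝ))⁻¹ = √(N : ℝ) * (N : ℝ)⁻¹ := by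
    have : √(N : ℝ) ≠ 0 := by positivity
    field_simp
    rw [Real.sq_sqrt (by positivity)]
  have h1 : U (empirical ℓ x N) - U m₀ =
      ∑ n ∈ Finset.range N, (U (interp m₀ N (n + 1) x) - U (interp m₀ N n x)) := by
    rw [Finset.sum_range_sub (fun n => U (interp m₀ N n x)), interp_self m₀ hN, interp_zero]
  have h2 : ∀ n, U (interp m₀ N (n + 1) x) - U (interp m₀ N n x) =
      (N : ℝ)⁻¹ * (linDeriv U m₀ (x n) - ∫ y, linDeriv U m₀ y ∂m₀.meas) +
        ((N : ℝ)⁻¹ * fluct U m₀ N n x (x n) + rem U m₀ N n x) := by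
    intro n
    rw [fluct, rem, integral_sub ((hU _).integrable_linDeriv _) ((hU _).integrable_linDeriv _)]
    ring
  rw [h1, hs]
  simp only [h2, Finset.sum_add_distrib, ← Finset.mul_sum]
  ring

/-- The interpolation lies on the segment from `m₀` to the empirical measure of `n` samples, so the
oscillation bound does not depend on `N`. -/
theorem Regular.abs_fluct_le {U : PSpace d ℓ → ℝ} {C : ℝ} (hU : Regular U C) (m₀ : PSpace d ℓ)
    {N n : ℕ} (hn : n ≤ N) (x : ℕ → E d) (y : E d) :
    |fluct U m₀ N n x y| ≤
      C * √(oscSq m₀ (empirical ℓ x n)) * (wt ℓ y + ∫ z, wt ℓ z ∂m₀.meas) := by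
  have h1 : ∀ z, |linDeriv U (interp m₀ N n x) z - linDeriv U m₀ z| ≤
      C * √(oscSq m₀ (empirical ℓ x n)) * wt ℓ z := fun z =>
    (hU.abs_linDeriv_segm_sub_le m₀ _ (ratio_mem hn) z).trans_eq (by ring)
  have h2 := norm_integral_le_of_norm_le
    (f := fun z => linDeriv U (interp m₀ N n x) z - linDeriv U m₀ z)
    (m₀.integrable_wt.const_mul _) (ae_of_all m₀.meas h1)
  rw [integral_const_mul] at h2
  rw [fluct, mul_add]
  exact (abs_sub _ _).trans (add_le_add (h1 y) h2)

theorem Regular.fluct_sq_le {U : PSpace d ℓ → ℝ} {C : ℝ} (hU : Regular U C) (m₀ : PSpace d ℓ)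
    {N n : ℕ} (hn : n ≤ N) (x : ℕ → E d) (y : E d) :
    fluct U m₀ N n x y ^ 2 ≤
      C ^ 2 * (oscSq m₀ (empirical ℓ x n) * (wt ℓ y + ∫ z, wt ℓ z ∂m₀.meas) ^ 2) := by
  rw [← sq_abs]
  refine (pow_le_pow_left₀ (abs_nonneg _) (hU.abs_fluct_le m₀ hn x y) 2).trans_eq ?_
  rw [mul_pow, mul_pow, Real.sq_sqrt (oscSq_nonneg _ _), mul_assoc]

theorem integral_fluct (U : PSpace d ℓ → ℝ) (hU : ∀ μ, AdmitsLinDeriv U μ) (m₀ : PSpace d ℓ)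
    (N n : ℕ) (x : ℕ → E d) : ∫ y, fluct U m₀ N n x y ∂m₀.meas = 0 := by
  have h : Integrable (fun y => linDeriv U (interp m₀ N n x) y - linDeriv U m₀ y) m₀.meas :=
    ((hU (interp m₀ N n x)).integrable_linDeriv m₀).sub ((hU m₀).integrable_linDeriv m₀)
  simp only [fluct]
  rw [integral_sub h (integrable_const _)]
  simp

theorem Regular.abs_rem_le {U : PSpace d ℓ → ℝ} {C : ℝ} (hU : Regular U C) (m₀ : PSpace d ℓ)
    {N n : ℕ} (hn : n < N) (x : ℕ → E d) :
    |rem U m₀ N n x| ≤ 8 * C * ((N : ℝ)⁻¹) ^ 2 * (1 + ‖x n‖ ^ ℓ + m₀.moment +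
      ((interp m₀ N n x).moment + (interp m₀ N (n + 1) x).moment)) :=
  hU.abs_sub_sub_le m₀ _ _ (x n) (by positivity) fun _ hg =>
    integral_interp_succ_sub m₀ hn x (hg m₀)

/-- The difference between the rescaled error and its linearisation. -/
noncomputable def linError (U : PSpace d ℓ → ℝ) (m₀ : PSpace d ℓ) {Ω : Type*} (ζ : ℕ → Ω → E d)
    (N : ℕ) (ω : Ω) : ℝ :=
  √(N : ℝ) * (U (empirical ℓ (fun k => ζ k ω) N) - U m₀) -
    (√(N : ℝ))⁻¹ * ∑ n ∈ Finset.range N, (linDeriv U m₀ (ζ n ω) - ∫ y, linDeriv U m₀ y ∂m₀.meas)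

theorem linError_eq {U : PSpace d ℓ → ℝ} {C : ℝ} {m₀ : PSpace d ℓ} {Ω : Type*}
    {ζ : ℕ → Ω → E d} (hU : Regular U C) {N : ℕ} (hN : N ≠ 0) (ω : Ω) :
    linError U m₀ ζ N ω =
      (√(N : ℝ))⁻¹ * ∑ n ∈ Finset.range N, fluct U m₀ N n (trunc n fun k => ζ k ω) (ζ n ω) +
        √(N : ℝ) * ∑ n ∈ Finset.range N, rem U m₀ N n fun k => ζ k ω := by
  rw [linError, sub_eq_sum U hU.admits m₀ hN]
  simp only [fluct_trunc]
  ring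

/-- This is the nonnegativity of the variance of `|f|`. -/
theorem integral_abs_le_sqrt [IsProbabilityMeasure P] {f : Ω → ℝ} (hf : MemLp f 2 P) :
    ∫ ω, |f ω| ∂P ≤ √(∫ ω, f ω ^ 2 ∂P) := by
  have h := variance_nonneg |f| P
  rw [variance_eq_sub hf.abs] at h
  apply Real.le_sqrt_of_sq_le
  simpa using h

/-! ### The linearisation error vanishes in mean -/

namespace Sampling

variable {m₀ : PSpace d ℓ} {S : Set (E d)} {ζ : ℕ → Ω → E d} {U : PSpace d ℓ → ℝ} {C : ℝ}

theorem integral_oscSq_mul (h : Sampling m₀ S ζ P) (n : ℕ) (c : ℝ) :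
    ∫ ω, oscSq m₀ (empirical ℓ (fun k => ζ k ω) n) * (wt ℓ (ζ n ω) + c) ^ 2 ∂P =
      (∫ ω, oscSq m₀ (empirical ℓ (fun k => ζ k ω) n) ∂P) *
        ∫ y, (wt ℓ y + c) ^ 2 ∂m₀.meas := by
  have := h.integral_past_mul n (fun x => oscSq m₀ (empirical ℓ x n))
    (((measurable_wt (ℓ := ℓ)).add_const c).pow_const 2)
  simpa only [empirical_trunc] using this

variable [IsProbabilityMeasure P]

theorem integral_abs_sum_le (h : Sampling m₀ S ζ P) (φ : ℕ → (ℕ → E d) → E d → ℝ)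
    (hφ : ∀ n x, ∫ y, φ n x y ∂m₀.meas = 0) (N : ℕ)
    (hL : ∀ n < N, MemLp (fun ω => φ n (trunc n (fun k => ζ k ω)) (ζ n ω)) 2 P) {b : ℕ → ℝ}
    (hb : ∀ n < N, ∫ ω, φ n (trunc n (fun k => ζ k ω)) (ζ n ω) ^ 2 ∂P ≤ b n) :
    ∫ ω, |(√(N : ℝ))⁻¹ * ∑ n ∈ Finset.range N, φ n (trunc n (fun k => ζ k ω)) (ζ n ω)| ∂P ≤
      √((N : ℝ)⁻¹ * ∑ n ∈ Finset.range N, b n) := by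
  have hM : MemLp (fun ω => ∑ n ∈ Finset.range N, φ n (trunc n (fun k => ζ k ω)) (ζ n ω)) 2 P :=
    memLp_finsetSum _ fun n hn => hL n (Finset.mem_range.1 hn)
  refine (integral_abs_le_sqrt (hM.const_mul _)).trans (Real.sqrt_le_sqrt ?_)
  simp only [mul_pow]
  rw [integral_const_mul, h.integral_sq_sum_eq φ hφ N hL, inv_pow, Real.sq_sqrt (by positivity)]
  gcongr with n hn
  exact hb n (Finset.mem_range.1 hn)

theorem integrable_oscSq_mul (h : Sampling m₀ S ζ P) (n : ℕ) (c : ℝ) :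
    Integrable (fun ω => oscSq m₀ (empirical ℓ (fun k => ζ k ω) n) * (wt ℓ (ζ n ω) + c) ^ 2) P := by
  have := h.integrable_past_mul n (fun x => oscSq m₀ (empirical ℓ x n))
    (((measurable_wt (ℓ := ℓ)).add_const c).pow_const 2)
    (by simpa only [empirical_trunc] using h.integrable_oscSq n) (m₀.integrable_wt_add_sq c)
  simpa only [empirical_trunc] using this

/-- The growth exponent `ℓ/2` of `δU/δm` is what makes squares integrable under a moment of order
`ℓ`. -/
theorem memLp_fluct (h : Sampling m₀ S ζ P) (hU : Regular U C) {N n : ℕ} (hn : n ≤ N) :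
    MemLp (fun ω => fluct U m₀ N n (trunc n (fun k => ζ k ω)) (ζ n ω)) 2 P := by
  have hm := (h.aemeasurable_pair n (fluct U m₀ N n)).aestronglyMeasurable
  refine (memLp_two_iff_integrable_sq hm).2
    (((h.integrable_oscSq_mul n (∫ z, wt ℓ z ∂m₀.meas)).const_mul (C ^ 2)).mono' (hm.pow 2)
      (ae_of_all _ fun ω => ?_))
  rw [Real.norm_of_nonneg (sq_nonneg _), fluct_trunc]
  exact hU.fluct_sq_le m₀ hn _ _

theorem integral_fluct_sq_le (h : Sampling m₀ S ζ P) (hU : Regular U C) {N n : ℕ} (hn : n ≤ N) :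
    ∫ ω, fluct U m₀ N n (trunc n (fun k => ζ k ω)) (ζ n ω) ^ 2 ∂P ≤
      C ^ 2 * ((∫ ω, oscSq m₀ (empirical ℓ (fun k => ζ k ω) n) ∂P) *
        ∫ y, (wt ℓ y + ∫ z, wt ℓ z ∂m₀.meas) ^ 2 ∂m₀.meas) := by
  rw [← h.integral_oscSq_mul, ← integral_const_mul]
  refine integral_mono (h.memLp_fluct hU hn).integrable_sq
    ((h.integrable_oscSq_mul n _).const_mul (C ^ 2)) fun ω => ?_
  rw [fluct_trunc]
  exact hU.fluct_sq_le m₀ hn _ _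

theorem integrable_remBound (h : Sampling m₀ S ζ P) {N n : ℕ} (hn : n < N) :
    Integrable (fun ω => 1 + ‖ζ n ω‖ ^ ℓ + m₀.moment + ((interp m₀ N n (fun k => ζ k ω)).moment +
      (interp m₀ N (n + 1) (fun k => ζ k ω)).moment)) P :=
  ((((integrable_const 1).add (h.integrable_norm_rpow n)).add (integrable_const _)).add
    ((h.integrable_moment_interp (by omega) hn.le).add (h.integrable_moment_interp (by omega) hn)))

theorem integrable_rem (h : Sampling m₀ S ζ P) (hU : Regular U C) {N n : ℕ} (hn : n < N) :
    Integrable (fun ω => rem U m₀ N n (fun k => ζ k ω)) P :=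
  ((h.integrable_remBound hn).const_mul _).mono'
    (h.aemeasurable_of_eq_past (n + 1) (rem_trunc U m₀ N n)).aestronglyMeasurable
    (ae_of_all _ fun _ => hU.abs_rem_le m₀ hn _)

/-- Every interpolation has mean moment exactly `m₀.moment`; two of these, the sample moment and the
explicit `m₀.moment` make up the `4`. -/
theorem integral_abs_rem_le (h : Sampling m₀ S ζ P) (hU : Regular U C) {N n : ℕ} (hn : n < N) :
    ∫ ω, |rem U m₀ N n (fun k => ζ k ω)| ∂P ≤
      8 * C * (1 + 4 * m₀.moment) * ((N : ℝ)⁻¹) ^ 2 := by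
  have hN : N ≠ 0 := by omega
  refine (integral_mono (h.integrable_rem hU hn).abs ((h.integrable_remBound hn).const_mul _)
    fun ω => hU.abs_rem_le m₀ hn _).trans_eq ?_
  have i1 := h.integrable_norm_rpow n
  have i2 := h.integrable_moment_interp hN hn.le
  have i3 := h.integrable_moment_interp hN (Nat.succ_le_of_lt hn)
  have e : ∫ ω, (1 + ‖ζ n ω‖ ^ ℓ + m₀.moment + ((interp m₀ N n (fun k => ζ k ω)).moment +
      (interp m₀ N (n + 1) (fun k => ζ k ω)).moment)) ∂P = 1 + 4 * m₀.moment := by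
    have i4 : Integrable (fun ω => 1 + ‖ζ n ω‖ ^ ℓ) P := (integrable_const 1).add i1
    have i5 : Integrable (fun ω => 1 + ‖ζ n ω‖ ^ ℓ + m₀.moment) P := i4.add (integrable_const _)
    have i6 : Integrable (fun ω => (interp m₀ N n (fun k => ζ k ω)).moment +
      (interp m₀ N (n + 1) (fun k => ζ k ω)).moment) P := i2.add i3
    rw [integral_add i5 i6, integral_add i4 (integrable_const _),
      integral_add (integrable_const 1) i1, integral_add i2 i3, h.integral_norm_rpow,
      h.integral_moment_interp hN hn.le, h.integral_moment_interp hN hn]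
    simp
    ring
  rw [integral_const_mul, e]
  ring

theorem integrable_linError_parts (h : Sampling m₀ S ζ P) (hU : Regular U C) (N : ℕ) :
    Integrable (fun ω => (√(N : ℝ))⁻¹ *
      ∑ n ∈ Finset.range N, fluct U m₀ N n (trunc n fun k => ζ k ω) (ζ n ω)) P ∧
    Integrable (fun ω => √(N : ℝ) * ∑ n ∈ Finset.range N, rem U m₀ N n fun k => ζ k ω) P :=
  ⟨(integrable_finsetSum _ fun _ hn =>
    (h.memLp_fluct hU (Finset.mem_range.1 hn).le).integrable one_le_two).const_mul _,
  (integrable_finsetSum _ fun _ hn => h.integrable_rem hU (Finset.mem_range.1 hn)).const_mul _⟩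

theorem integrable_linError (h : Sampling m₀ S ζ P) (hU : Regular U C) {N : ℕ} (hN : N ≠ 0) :
    Integrable (linError U m₀ ζ N) P := by
  rw [funext (linError_eq hU hN)]
  exact (h.integrable_linError_parts hU N).1.add (h.integrable_linError_parts hU N).2

theorem tendsto_integral_abs_linError (h : Sampling m₀ S ζ P) (hU : Regular U C) :
    Tendsto (fun N => ∫ ω, |linError U m₀ ζ N ω| ∂P) atTop (𝓝 0) := by
  set b : ℕ → ℝ := fun n => C ^ 2 * ((∫ ω, oscSq m₀ (empirical ℓ (fun k => ζ k ω) n) ∂P) *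
        ∫ y, (wt ℓ y + ∫ z, wt ℓ z ∂m₀.meas) ^ 2 ∂m₀.meas) with hb
  have hb0 : Tendsto b atTop (𝓝 0) := by
    simpa using (h.tendsto_integral_oscSq.mul_const
      (∫ y, (wt ℓ y + ∫ z, wt ℓ z ∂m₀.meas) ^ 2 ∂m₀.meas)).const_mul (C ^ 2)
  set K := 8 * C * (1 + 4 * m₀.moment) with hK
  refine squeeze_zero' (Eventually.of_forall fun N => integral_nonneg fun ω => abs_nonneg _)
    (g := fun N : ℕ => √((N : ℝ)⁻¹ * ∑ n ∈ Finset.range N, b n) + K * (√(N : ℝ))⁻¹) ?_ ?_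
  · filter_upwards [eventually_ne_atTop 0] with N hN
    obtain ⟨i1, i2⟩ := h.integrable_linError_parts hU N
    have hrem : ∫ ω, |√(N : ℝ) * ∑ n ∈ Finset.range N, rem U m₀ N n fun k => ζ k ω| ∂P ≤
        K * (√(N : ℝ))⁻¹ := by
      have hi : ∀ n ∈ Finset.range N, Integrable (fun ω => |rem U m₀ N n fun k => ζ k ω|) P :=
        fun n hn => (h.integrable_rem hU (Finset.mem_range.1 hn)).abs
      calc _ ≤ ∫ ω, √(N : ℝ) * ∑ n ∈ Finset.range N, |rem U m₀ N n fun k => ζ k ω| ∂P := by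
            refine integral_mono i2.abs ((integrable_finsetSum _ hi).const_mul _) fun ω => ?_
            dsimp only
            rw [abs_mul, abs_of_nonneg (Real.sqrt_nonneg _)]
            gcongr
            exact Finset.abs_sum_le_sum_abs _ _
        _ ≤ √(N : ℝ) * ∑ n ∈ Finset.range N, K * ((N : ℝ)⁻¹) ^ 2 := by
            rw [integral_const_mul, integral_finsetSum _ hi]
            gcongr with n hn
            exact h.integral_abs_rem_le hU (Finset.mem_range.1 hn)
        _ = K * (√(N : ℝ))⁻¹ := by
            have hN' : (N : ℝ) ≠ 0 := Nat.cast_ne_zero.2 hN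
            have hs : √(N : ℝ) ≠ 0 := by positivity
            rw [Finset.sum_const, Finset.card_range, nsmul_eq_mul]
            field_simp
            rw [Real.sq_sqrt (by positivity)]
    calc _ ≤ ∫ ω, (|(√(N : ℝ))⁻¹ *
            ∑ n ∈ Finset.range N, fluct U m₀ N n (trunc n fun k => ζ k ω) (ζ n ω)| +
          |√(N : ℝ) * ∑ n ∈ Finset.range N, rem U m₀ N n fun k => ζ k ω|) ∂P := by
          refine integral_mono (h.integrable_linError hU hN).abs (i1.abs.add i2.abs) fun ω => ?_
          dsimp only
          rw [linError_eq hU hN]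
          exact abs_add_le _ _
      _ ≤ _ := by
          rw [integral_add i1.abs i2.abs]
          exact add_le_add (h.integral_abs_sum_le (fluct U m₀ N) (integral_fluct U hU.admits m₀ N) N
            (fun n hn => h.memLp_fluct hU hn.le) fun n hn => h.integral_fluct_sq_le hU hn.le) hrem
  -- The means of the squared fluctuations tend to `0`, hence so do their Cesàro averages.
  · have h1 := (Real.continuous_sqrt.tendsto 0).comp hb0.cesaro
    have h2 : Tendsto (fun N : ℕ => (√(N : ℝ))⁻¹) atTop (𝓝 0) :=
      (Real.tendsto_sqrt_atTop.comp tendsto_natCast_atTop_atTop).inv_tendsto_atTop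
    simpa using h1.add (h2.const_mul K)

end Sampling

end EmpiricalCLT

namespace EmpiricalCLT

variable {d : ℕ} {ℓ : ℝ} {Ω : Type*} [MeasurableSpace Ω] {P : Measure Ω}

namespace Sampling

variable {m₀ : PSpace d ℓ} {S : Set (E d)} {ζ : ℕ → Ω → E d} {U : PSpace d ℓ → ℝ} {C : ℝ}

/-! ### Central limit theorem and moment bound -/

theorem memLp_linDeriv (h : Sampling m₀ S ζ P) (hU : Regular U C) (n : ℕ) :
    MemLp (fun ω => linDeriv U m₀ (ζ n ω)) 2 P := by
  have hg := (hU.admits m₀).measurable_linDeriv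
  refine (memLp_two_iff_integrable_sq (hg.comp (h.meas n)).aestronglyMeasurable).2
    (h.integrable_comp (g := fun y => linDeriv U m₀ y ^ 2) ?_ n)
  refine m₀.integrable_of_growth (hg.pow_const 2) (C := 2 * (C * (1 + √m₀.moment)) ^ 2) fun y => ?_
  rw [abs_of_nonneg (sq_nonneg _), ← sq_abs]
  calc _ ≤ (C * wt ℓ y * (1 + √m₀.moment)) ^ 2 :=
        pow_le_pow_left₀ (abs_nonneg _) (hU.abs_le m₀ y) 2
    _ = (C * (1 + √m₀.moment)) ^ 2 * wt ℓ y ^ 2 := by ring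
    _ ≤ (C * (1 + √m₀.moment)) ^ 2 * (2 * (1 + ‖y‖ ^ ℓ)) := by gcongr; exact wt_sq_le y
    _ = _ := by ring

variable [IsProbabilityMeasure P]

theorem tendstoInDistribution_linear (h : Sampling m₀ S ζ P) (hU : Regular U C) :
    TendstoInDistribution
      (fun (N : ℕ) ω => (√(N : ℝ))⁻¹ *
        ∑ n ∈ Finset.range N, (linDeriv U m₀ (ζ n ω) - ∫ y, linDeriv U m₀ y ∂m₀.meas))
      atTop (fun z : ℝ => z) (fun _ => P)
      (gaussianReal 0 (Var[fun ω => linDeriv U m₀ (ζ 0 ω); P]).toNNReal) := by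
  have hg := (hU.admits m₀).measurable_linDeriv
  have := tendstoInDistribution_inv_sqrt_mul_sum_sub (P := P)
    (X := fun n ω => linDeriv U m₀ (ζ n ω)) (Y := fun z : ℝ => z) HasLaw.id
    (h.memLp_linDeriv hU 0) (h.indep.comp (fun _ => linDeriv U m₀) fun _ => hg)
    (h.identDistrib hg)
  simpa [h.integral_comp hg, Finset.sum_sub_distrib] using this

/-- The orthogonality estimate with increments that ignore the past. The bound is the standard
deviation of a single term, whatever `N` is. -/
theorem exists_integral_abs_linear_le (h : Sampling m₀ S ζ P) (hU : Regular U C) :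
    ∃ K : ℝ, ∀ N : ℕ, N ≠ 0 → ∫ ω, |(√(N : ℝ))⁻¹ * ∑ n ∈ Finset.range N,
      (linDeriv U m₀ (ζ n ω) - ∫ y, linDeriv U m₀ y ∂m₀.meas)| ∂P ≤ K := by
  have hg := (hU.admits m₀).measurable_linDeriv
  set c := ∫ y, linDeriv U m₀ y ∂m₀.meas with hc
  refine ⟨√(∫ y, (linDeriv U m₀ y - c) ^ 2 ∂m₀.meas), fun N hN => ?_⟩
  refine (h.integral_abs_sum_le (fun _ _ y => linDeriv U m₀ y - c) (fun _ _ => ?_) N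
    (fun n _ => (h.memLp_linDeriv hU n).sub (memLp_const c))
    (b := fun _ => ∫ y, (linDeriv U m₀ y - c) ^ 2 ∂m₀.meas) fun n _ =>
      (h.integral_comp ((hg.sub_const c).pow_const 2) n).le).trans_eq ?_
  · rw [integral_sub ((hU.admits m₀).integrable_linDeriv m₀) (integrable_const _)]
    simp [hc]
  · have : (N : ℝ) ≠ 0 := Nat.cast_ne_zero.2 hN
    rw [Finset.sum_const, Finset.card_range, nsmul_eq_mul, inv_mul_cancel_left₀ this]

theorem integrable_linear (h : Sampling m₀ S ζ P) (hU : Regular U C) (N : ℕ) :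
    Integrable (fun ω => (√(N : ℝ))⁻¹ * ∑ n ∈ Finset.range N,
      (linDeriv U m₀ (ζ n ω) - ∫ y, linDeriv U m₀ y ∂m₀.meas)) P :=
  (integrable_finsetSum _ fun n _ => ((h.memLp_linDeriv hU n).integrable one_le_two).sub
    (integrable_const _)).const_mul _

theorem aestronglyMeasurable_linError (h : Sampling m₀ S ζ P) (hU : Regular U C) (N : ℕ) :
    AEStronglyMeasurable (linError U m₀ ζ N) P :=
  (((h.aemeasurable_empirical U N).sub_const _).const_mul _).aestronglyMeasurable.sub
    (h.integrable_linear hU N).aestronglyMeasurable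

theorem tendstoInMeasure_linError (h : Sampling m₀ S ζ P) (hU : Regular U C) :
    TendstoInMeasure P (linError U m₀ ζ) atTop fun _ => 0 := by
  refine tendstoInMeasure_of_tendsto_eLpNorm one_ne_zero (h.aestronglyMeasurable_linError hU)
    aestronglyMeasurable_const ?_
  have := ENNReal.tendsto_ofReal (h.tendsto_integral_abs_linError hU)
  rw [ENNReal.ofReal_zero] at this
  refine this.congr' ?_
  filter_upwards [eventually_ne_atTop 0] with N hN
  rw [eLpNorm_one_eq_lintegral_enorm,
    ← ofReal_integral_norm_eq_lintegral_enorm ((h.integrable_linError hU hN).sub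
      (integrable_const 0))]
  simp

/-- Slutsky's theorem: the linear part converges in law and the linearisation error tends to `0` in
probability. -/
theorem tendstoInDistribution (h : Sampling m₀ S ζ P) (hU : Regular U C) :
    TendstoInDistribution
      (fun (N : ℕ) ω => √(N : ℝ) * (U (empirical ℓ (fun i => ζ i ω) N) - U m₀))
      atTop (fun z : ℝ => z) (fun _ => P)
      (gaussianReal 0 (Var[fun ω => linDeriv U m₀ (ζ 0 ω); P]).toNNReal) := by
  have := (h.tendstoInDistribution_linear hU).add_of_tendstoInMeasure_const
    (h.tendstoInMeasure_linError hU) fun N => (h.aestronglyMeasurable_linError hU N).aemeasurable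
  simp only [add_zero] at this
  convert! this using 3 with N
  simp [linError]

/-- Integrability is part of the claim, since the Bochner integral of a non-integrable function is
`0` and the bound alone would then be void. -/
theorem exists_integral_abs_le (h : Sampling m₀ S ζ P) (hU : Regular U C) :
    ∃ K : ℝ, ∀ N : ℕ, 1 ≤ N →
      Integrable (fun ω => U (empirical ℓ (fun i => ζ i ω) N) - U m₀) P ∧
      √(N : ℝ) * ∫ ω, |U (empirical ℓ (fun i => ζ i ω) N) - U m₀| ∂P ≤ K := by
  obtain ⟨K₁, hK₁⟩ := h.exists_integral_abs_linear_le hU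
  -- A convergent sequence is bounded, so no separate uniform estimate of the linearisation error is
  -- needed.
  obtain ⟨K₂, hK₂⟩ := (h.tendsto_integral_abs_linError hU).bddAbove_range
  refine ⟨K₁ + K₂, fun N hN => ?_⟩
  have hN0 : N ≠ 0 := by omega
  have hs : √(N : ℝ) ≠ 0 := by positivity
  have i1 := h.integrable_linear hU N
  have i2 := h.integrable_linError hU hN0
  have e : ∀ ω, √(N : ℝ) * (U (empirical ℓ (fun i => ζ i ω) N) - U m₀) =
      (√(N : ℝ))⁻¹ * ∑ n ∈ Finset.range N,
        (linDeriv U m₀ (ζ n ω) - ∫ y, linDeriv U m₀ y ∂m₀.meas) + linError U m₀ ζ N ω :=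
    fun ω => by rw [linError]; ring
  have hi : Integrable (fun ω => √(N : ℝ) * (U (empirical ℓ (fun i => ζ i ω) N) - U m₀)) P := by
    simp only [e]
    exact i1.add i2
  refine ⟨by simpa [hs] using hi.const_mul (√(N : ℝ))⁻¹, ?_⟩
  calc _ = ∫ ω, |√(N : ℝ) * (U (empirical ℓ (fun i => ζ i ω) N) - U m₀)| ∂P := by
        rw [← integral_const_mul]
        simp only [abs_mul, abs_of_nonneg (Real.sqrt_nonneg _)]
    _ ≤ ∫ ω, (|(√(N : ℝ))⁻¹ * ∑ n ∈ Finset.range N,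
        (linDeriv U m₀ (ζ n ω) - ∫ y, linDeriv U m₀ y ∂m₀.meas)| + |linError U m₀ ζ N ω|) ∂P := by
        refine integral_mono hi.abs (i1.abs.add i2.abs) fun ω => ?_
        dsimp only
        rw [e]
        exact abs_add_le _ _
    _ ≤ K₁ + K₂ := by
        rw [integral_add i1.abs i2.abs]
        exact add_le_add (hK₁ N hN0) (hK₂ ⟨N, rfl⟩)

end Sampling

end EmpiricalCLT

theorem mainTheorem4 {d : ℕ} {ℓ : ℝ} (hℓ : 0 ≤ ℓ)
    (m₀ : EmpiricalCLT.PSpace d ℓ) (hm₀ : m₀.IsDiscrete)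
    (U : EmpiricalCLT.PSpace d ℓ → ℝ)
    (hU₁ : EmpiricalCLT.ClassS 1 (ℓ / 2) U)
    (hU₂ : EmpiricalCLT.ClassS 2 ℓ U)
    (hU : ∃ C : ℝ, ∀ (μ : EmpiricalCLT.PSpace d ℓ) (x y : EmpiricalCLT.E d),
      |EmpiricalCLT.iterLinDeriv U 2 μ ![x, y]| ≤
        C * (1 + ‖x‖ ^ (ℓ / 2) + ‖y‖ ^ ℓ + μ.moment))
    {Ω : Type*} [MeasurableSpace Ω] (P : Measure Ω) [IsProbabilityMeasure P]
    (ζ : ℕ → Ω → EmpiricalCLT.E d)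
    (hζ_meas : ∀ i, Measurable (ζ i))
    (hζ_indep : iIndepFun ζ P)
    (hζ_law : ∀ i, P.map (ζ i) = m₀.meas) :
    TendstoInDistribution
      (fun (N : ℕ) (ω : Ω) =>
        √(N : ℝ) * (U (EmpiricalCLT.empirical ℓ (fun i => ζ i ω) N) - U m₀))
      atTop (fun z : ℝ => z) (fun _ => P)
      (gaussianReal 0 (Var[fun ω => EmpiricalCLT.linDeriv U m₀ (ζ 0 ω); P]).toNNReal) ∧
    ∃ K : ℝ, ∀ N : ℕ, 1 ≤ N →
      Integrable (fun ω => U (EmpiricalCLT.empirical ℓ (fun i => ζ i ω) N) - U m₀) P ∧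
      √(N : ℝ) * ∫ ω, |U (EmpiricalCLT.empirical ℓ (fun i => ζ i ω) N) - U m₀| ∂P ≤ K := by
  obtain ⟨S, hS, hS1⟩ := hm₀
  obtain ⟨C, hC⟩ := EmpiricalCLT.exists_regular hU₁ hU₂ hU
  have h : EmpiricalCLT.Sampling m₀ S ζ P := ⟨hζ_meas, hζ_indep, hζ_law, hS, hS1⟩
  exact ⟨h.tendstoInDistribution hC, h.exists_integral_abs_le hC⟩
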